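/- **Setting.** A constraint satisfaction problem (CSP) $S$ specifies, for every positive integer $n$, an alphabet size $w$, a number $\ell$ of variables $x_1,\dots,x_\ell$, an arity $q$, a set $W\subseteq\{0,\dots,w-1\}^{\ell}$ of admissible assignments, and a set $\mathcal R$ of $q$-ary relations on $\{0,\dots,w-1\}$ ($s=|\mathcal R|$). An instance is a sequence $C_1,\dots,C_m$ of constraints (repetitions allowed), each of the form $R(x_{j_1},\dots,x_{j_q})$ with $R\in\mathcal R$ and distinct indices $j_1,\dots,j_q$; its size is $n+m(\log s+q\log \ell)+\ell\log w$, where $\log k$ is read as the number of binary digits of $k$. In the hidden problem with $\{\mathcal V\}$-revealing oracle, an algorithm is given only $n$ and $m$, and may repeatedly propose assignments $a\in W$ (and only such) to an oracle. If $a$ satisfies all constraints, the oracle answers YES; otherwise it reveals the index $j$ of some constraint $C_j$ violated by $a$ together with the tuple $(j_1,\dots,j_q)$ of indices of its variables, but not its relation (which violated constraint is revealed is arbitrary and may change from query to query). The algorithm solves the hidden problem if, for all $n\ge 1$ and $m$, for every instance and every such oracle for it, it outputs an assignment in $W$ that satisfies the instance if there is one, and NO otherwise. The hidden problem is in polynomial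 time if it is solved by one algorithm whose number of steps, a query counting as one step, is bounded by a polynomial in the instance size. **Theorem.** With a $\{\mathcal V\}$-revealing oracle, the hidden versions of the following CSPs are in polynomial time. (a) 2-SAT: $w=2$, $q=2$, $\ell=n$, $W=\{0,1\}^n$, and $\mathcal R$ consists of the ten relations $\mathrm T$, $\mathrm F$, $\alpha$, $\beta$, $\neg\alpha$, $\neg\beta$, $\alpha\vee\beta$, $\alpha\vee\neg\beta$, $\neg\alpha\vee\beta$, $\neg\alpha\vee\neg\beta$ in two Boolean variables $\alpha,\beta$; more generally, the CSP with the same $w,q,\ell,W$ and with an arbitrary set $\mathcal R$ (possibly depending on $n$) of binary relations on $\{0,1\}$. (b) Exact Unique Games over the alphabet $\{0,1\}$: $w=2$, $q=2$, $\ell=n$, $W=\{0,1\}^n$, and $\mathcal R$ consists of the relations $\{(\alpha,\beta):\pi(\alpha)=\beta\}$ for the permutations $\pi$ of $\{0,1\}$. (c) Any monotone graph property decidable in polynomial time. Let $\mathcal P$ be a property of (labelled) graphs on the vertex set $\{1,\dots,n\}$, for every $n$, that is decidable in time polynomial in $n$. If $\mathcal P$ is monotone increasing (preserved under adding edges), the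 CSP has one Boolean variable for each of the $\ell=\binom n2$ pairs of vertices, $w=2$, $q=1$, $W$ is the set of graphs that satisfy $\mathcal P$ and are minimal with respect to inclusion of edge sets, and $\mathcal R=\{\mathsf{Neg}\}$ with $\mathsf{Neg}=\{0\}$ (so a constraint forbids an edge). If $\mathcal P$ is monotone decreasing, then $W$ is the set of inclusion-maximal graphs satisfying $\mathcal P$ and $\mathcal R=\{\mathsf{Id}\}$ with $\mathsf{Id}=\{1\}$. The same holds for properties of directed graphs (loops allowed), with the $\ell=n^2$ ordered pairs of vertices as variables. (d) Equality to a spanning tree: $w=2$, $q=1$, $\ell=\binom n2$ (one variable for each pair of vertices), $W$ is the set of (edge sets of) trees on the vertex set $\{1,\dots,n\}$, and $\mathcal R=\{\mathsf{Id},\mathsf{Neg}\}$. -/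

import Mathlib

namespace HiddenCSP

/-! ### Machine model

Programs of a structured `while` language over binary trees, extended by a query command. Every
executed command (assignment, test, query) costs one step; the expressions occurring in a program
have constant size. With trees kept as shared pointer structures, each step costs a Turing machine
time polynomial in the number of steps made so far, so this unit-cost model defines the usual class
of polynomial-time algorithms. -/

/-- The values that programs work on: binary trees with unlabelled leaves. -/
inductive Dat : Type
  | nil : Dat
  | cons : Dat → Dat → Dat

/-- A natural number in unary notation. -/
def Dat.ofNat : ℕ → Dat
  | 0 => .nil
  | k + 1 => .cons .nil (Dat.ofNat k)

/-- A list of values. -/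
def Dat.ofList : List Dat → Dat
  | [] => .nil
  | d :: l => .cons d (Dat.ofList l)

/-- The list of the values of a function on `Fin k` with values in some `Fin r`. -/
def Dat.ofTuple {k r : ℕ} (a : Fin k → Fin r) : Dat :=
  Dat.ofList (List.ofFn fun i => Dat.ofNat (a i))

theorem Dat.ofNat_injective : Function.Injective Dat.ofNat := by
  intro a
  induction a with
  | zero => intro b h; cases b <;> simp_all [Dat.ofNat]
  | succ a ih =>
    intro b h
    cases b with
    | zero => simp [Dat.ofNat] at h
    | succ b => simp only [Dat.ofNat, Dat.cons.injEq, true_and] at h; rw [ih h]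

theorem Dat.ofList_injective : Function.Injective Dat.ofList := by
  intro a
  induction a with
  | nil => intro b h; cases b <;> simp_all [Dat.ofList]
  | cons x a ih =>
    intro b h
    cases b with
    | nil => simp [Dat.ofList] at h
    | cons y b => simp only [Dat.ofList, Dat.cons.injEq] at h; rw [h.1, ih h.2]

theorem Dat.ofTuple_injective {k r : ℕ} :
    Function.Injective (Dat.ofTuple : (Fin k → Fin r) → Dat) := fun a b h => by
  have h := List.ofFn_injective (Dat.ofList_injective h)
  funext i
  exact Fin.ext (Dat.ofNat_injective (congrFun h i))

def Dat.head : Dat → Dat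
  | .nil => .nil
  | .cons d _ => d

def Dat.tail : Dat → Dat
  | .nil => .nil
  | .cons _ d => d

/-- Expressions; the program variables are numbered. -/
inductive Expr : Type
  | var : ℕ → Expr
  | nil : Expr
  | cons : Expr → Expr → Expr
  | head : Expr → Expr
  | tail : Expr → Expr

/-- The contents of all program variables. -/
abbrev Store : Type := ℕ → Dat

def Expr.eval (σ : Store) : Expr → Dat
  | .var x => σ x
  | .nil => .nil
  | .cons e f => .cons (e.eval σ) (f.eval σ)
  | .head e => (e.eval σ).head
  | .tail e => (e.eval σ).tail

/-- Commands. The tests in `ite` and `loop` succeed if the value of the expression is not `nil`;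
`query x e` sends the value of `e` to the oracle and stores the reply in the variable `x`. -/
inductive Cmd : Type
  | assign : ℕ → Expr → Cmd
  | query : ℕ → Expr → Cmd
  | seq : Cmd → Cmd → Cmd
  | ite : Expr → Cmd → Cmd → Cmd
  | loop : Expr → Cmd → Cmd

/-- `O k d r`: if exactly `k` queries have been made before, then the query `d` is admissible and is
answered by `r`. An execution that makes an inadmissible query is stuck. -/
abbrev Oracle : Type := ℕ → Dat → Dat → Prop

/-- The oracle that admits no query, for ordinary computations. -/
def noOracle : Oracle := fun _ _ _ => False

/-- `Exec O c σ k σ' k' t`: started in the store `σ` after `k` oracle queries, the program `c` halts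
after `t` steps in the store `σ'`, the number of queries made then being `k'`. -/
inductive Exec (O : Oracle) : Cmd → Store → ℕ → Store → ℕ → ℕ → Prop
  | assign (x : ℕ) (e : Expr) (σ : Store) (k : ℕ) :
      Exec O (.assign x e) σ k (Function.update σ x (e.eval σ)) k 1
  | query (x : ℕ) (e : Expr) (σ : Store) (k : ℕ) (r : Dat) (h : O k (e.eval σ) r) :
      Exec O (.query x e) σ k (Function.update σ x r) (k + 1) 1
  | seq {c d : Cmd} {σ σ' σ'' : Store} {k k' k'' t t' : ℕ}
      (h : Exec O c σ k σ' k' t) (h' : Exec O d σ' k' σ'' k'' t') :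
      Exec O (.seq c d) σ k σ'' k'' (t + t')
  | ite_true {e : Expr} {c d : Cmd} {σ σ' : Store} {k k' t : ℕ} (he : e.eval σ ≠ .nil)
      (h : Exec O c σ k σ' k' t) : Exec O (.ite e c d) σ k σ' k' (t + 1)
  | ite_false {e : Expr} {c d : Cmd} {σ σ' : Store} {k k' t : ℕ} (he : e.eval σ = .nil)
      (h : Exec O d σ k σ' k' t) : Exec O (.ite e c d) σ k σ' k' (t + 1)
  | loop_done {e : Expr} {c : Cmd} {σ : Store} {k : ℕ} (he : e.eval σ = .nil) :
      Exec O (.loop e c) σ k σ k 1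
  | loop_step {e : Expr} {c : Cmd} {σ σ' σ'' : Store} {k k' k'' t t' : ℕ} (he : e.eval σ ≠ .nil)
      (h : Exec O c σ k σ' k' t) (h' : Exec O (.loop e c) σ' k' σ'' k'' t') :
      Exec O (.loop e c) σ k σ'' k'' (t + t' + 1)

/-- On input `d` and with the oracle `O`, the program `c` halts with output `r` after `t` steps.
Input and output stand in the variable `0`; the other variables are initially `nil`. -/
def Computes (O : Oracle) (c : Cmd) (d r : Dat) (t : ℕ) : Prop :=
  ∃ (σ : Store) (k : ℕ), Exec O c (Function.update (fun _ => Dat.nil) 0 d) 0 σ k t ∧ σ 0 = r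

/-- Executions are deterministic, if the oracle gives only one answer to each query. -/
theorem Exec.deterministic {O : Oracle} (hO : ∀ k d r r', O k d r → O k d r' → r = r')
    {c : Cmd} {σ σ₁ : Store} {k k₁ t₁ : ℕ} (h : Exec O c σ k σ₁ k₁ t₁) :
    ∀ {σ₂ : Store} {k₂ t₂ : ℕ}, Exec O c σ k σ₂ k₂ t₂ → σ₁ = σ₂ ∧ k₁ = k₂ ∧ t₁ = t₂ := by
  induction h with
  | assign => rintro _ _ _ ⟨⟩; exact ⟨rfl, rfl, rfl⟩
  | query x e σ k r h =>
    intro _ _ _ h2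
    cases h2 with
    | query _ _ _ _ r' h' => rw [hO _ _ _ _ h h']; exact ⟨rfl, rfl, rfl⟩
  | seq _ _ ih1 ih2 =>
    intro _ _ _ h2
    cases h2 with
    | seq a b =>
      obtain ⟨rfl, rfl, rfl⟩ := ih1 a
      obtain ⟨rfl, rfl, rfl⟩ := ih2 b
      exact ⟨rfl, rfl, rfl⟩
  | ite_true he _ ih =>
    intro _ _ _ h2
    cases h2 with
    | ite_true _ a => obtain ⟨rfl, rfl, rfl⟩ := ih a; exact ⟨rfl, rfl, rfl⟩
    | ite_false he' _ => exact absurd he' he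
  | ite_false he _ ih =>
    intro _ _ _ h2
    cases h2 with
    | ite_true he' _ => exact absurd he he'
    | ite_false _ a => obtain ⟨rfl, rfl, rfl⟩ := ih a; exact ⟨rfl, rfl, rfl⟩
  | loop_done he =>
    intro _ _ _ h2
    cases h2 with
    | loop_done => exact ⟨rfl, rfl, rfl⟩
    | loop_step he' _ _ => exact absurd he he'
  | loop_step he _ _ ih1 ih2 =>
    intro _ _ _ h2
    cases h2 with
    | loop_done he' => exact absurd he' he
    | loop_step _ a b =>
      obtain ⟨rfl, rfl, rfl⟩ := ih1 a
      obtain ⟨rfl, rfl, rfl⟩ := ih2 b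
      exact ⟨rfl, rfl, rfl⟩

/-! ### Constraint satisfaction problems -/

/-- A constraint satisfaction problem: for every `n`, an alphabet size, an assignment length, a set
of admissible assignments, an arity, and a set of relations of this arity. -/
structure CSP where
  /-- alphabet size -/
  w : ℕ → ℕ
  /-- assignment length, i.e. number of variables -/
  len : ℕ → ℕ
  /-- arity -/
  q : ℕ → ℕ
  /-- admissible assignments -/
  W : ∀ n, Set (Fin (len n) → Fin (w n))
  /-- type: the set of relations -/
  rels : ∀ n, Set (Set (Fin (q n) → Fin (w n)))

namespace CSP

variable (S : CSP)

abbrev Assignment (n : ℕ) : Type := Fin (S.len n) → Fin (S.w n)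

/-- A relation of the type, applied to a tuple of distinct variables. -/
structure Constraint (n : ℕ) where
  rel : Set (Fin (S.q n) → Fin (S.w n))
  rel_mem : rel ∈ S.rels n
  vars : Fin (S.q n) ↪ Fin (S.len n)

/-- An instance: a sequence of `m` constraints, in which repetitions are allowed. -/
abbrev Instance (n m : ℕ) : Type := Fin m → S.Constraint n

/-- The number of relations. -/
noncomputable def s (n : ℕ) : ℕ := (S.rels n).ncard

/-- The size `n + m (log s + q log ℓ) + ℓ log w` of an instance, where the logarithm of a number
is taken as the number of its binary digits. -/
noncomputable def size (n m : ℕ) : ℕ :=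
  n + m * (Nat.size (S.s n) + S.q n * Nat.size (S.len n)) + S.len n * Nat.size (S.w n)

variable {S}
variable {n m : ℕ}

def Constraint.Sat (c : S.Constraint n) (a : S.Assignment n) : Prop :=
  (fun i => a (c.vars i)) ∈ c.rel

def Satisfies (a : S.Assignment n) (C : S.Instance n m) : Prop := ∀ j, (C j).Sat a

/-- A solution: a satisfying admissible assignment if there is one, and `none` (NO) otherwise. -/
def IsSolution (C : S.Instance n m) : Option (S.Assignment n) → Prop
  | some a => a ∈ S.W n ∧ Satisfies a C
  | none => ∀ a ∈ S.W n, ¬ Satisfies a C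

/-- What the oracle answers to a proposed assignment: `none` is YES, and `some (j, v)` says that the
`j`-th constraint is violated and that `v` is the tuple of its variables. -/
abbrev Answer (S : CSP) (n m : ℕ) : Type := Option (Fin m × (Fin (S.q n) → Fin (S.len n)))

/-- The correct answers of a variable-revealing oracle for `C` to the proposal `a`. -/
def CorrectAnswer (C : S.Instance n m) (a : S.Assignment n) : S.Answer n m → Prop
  | none => Satisfies a C
  | some (j, v) => ¬ (C j).Sat a ∧ v = (C j).vars

/-- `V k a` is the answer to the proposal `a` if it is the query number `k`. The dependence on `k`
lets an oracle disclose different violated constraints when it is asked again. -/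
def IsRevealing (C : S.Instance n m) (V : ℕ → S.Assignment n → S.Answer n m) : Prop :=
  ∀ k, ∀ a ∈ S.W n, CorrectAnswer C a (V k a)

def encodeAnswer : S.Answer n m → Dat
  | none => .nil
  | some (j, v) => .cons (Dat.ofNat j) (Dat.ofTuple v)

def encodeOutput : Option (S.Assignment n) → Dat
  | none => .nil
  | some a => .cons .nil (Dat.ofTuple a)

/-- The oracle as seen by a program: only admissible assignments may be proposed. -/
def oracle (V : ℕ → S.Assignment n → S.Answer n m) : Oracle :=
  fun k d r => ∃ a ∈ S.W n, d = Dat.ofTuple a ∧ r = encodeAnswer (V k a)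

theorem oracle_functional (V : ℕ → S.Assignment n → S.Answer n m) (k : ℕ) (d r r' : Dat)
    (h : oracle V k d r) (h' : oracle V k d r') : r = r' := by
  obtain ⟨a, _, rfl, rfl⟩ := h
  obtain ⟨b, _, hd, rfl⟩ := h'
  rw [Dat.ofTuple_injective hd]

variable (S)

/-- The hidden problem with variable-revealing oracle is solvable in polynomial time: a single
program, given only `n` and `m` and access to an arbitrary revealing oracle of an arbitrary
instance, outputs a solution of this instance in time polynomial in the instance size. -/
def HiddenPolyTime : Prop :=
  ∃ (c : Cmd) (p : Polynomial ℕ), ∀ n m : ℕ, 0 < n → ∀ C : S.Instance n m,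
    ∀ V : ℕ → S.Assignment n → S.Answer n m, IsRevealing C V →
      ∃ (t : ℕ) (out : Option (S.Assignment n)),
        Computes (oracle V) c (.cons (Dat.ofNat n) (Dat.ofNat m)) (encodeOutput out) t ∧
          t ≤ p.eval (S.size n m) ∧ IsSolution C out

end CSP

/-! ### The problems -/

/-- The problem with `n` Boolean variables (`1` is true, `0` is false), all assignments admissible,
and the given sets of binary relations. -/
def binaryBoolean (R : ℕ → Set (Set (Fin 2 → Fin 2))) : CSP where
  w _ := 2
  len n := n
  q _ := 2
  W _ := Set.univ
  rels := R

/-- Satisfiability of conjunctions of disjunctions of at most two literals. -/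
def twoSAT : CSP := binaryBoolean fun _ =>
  {Set.univ, ∅, {b | b 0 = 1}, {b | b 1 = 1}, {b | b 0 = 0}, {b | b 1 = 0},
    {b | b 0 = 1 ∨ b 1 = 1}, {b | b 0 = 1 ∨ b 1 = 0},
    {b | b 0 = 0 ∨ b 1 = 1}, {b | b 0 = 0 ∨ b 1 = 0}}

/-- Exact unique games over an alphabet with `k` letters: label `n` vertices such that for each
edge the label of one end point is sent to that of the other by the permutation of the edge. -/
def uniqueGames (k : ℕ) : CSP where
  w _ := k
  len n := n
  q _ := 2
  W _ := Set.univ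
  rels _ := {R | ∃ π : Equiv.Perm (Fin k), R = {b | π (b 0) = b 1}}

/-- The unary Boolean relation satisfied by `1` only. -/
def idRel : Set (Fin 1 → Fin 2) := {b | b 0 = 1}

/-- The unary Boolean relation satisfied by `0` only. -/
def negRel : Set (Fin 1 → Fin 2) := {b | b 0 = 0}

/-- The graph on `n` vertices given by `n choose 2` bits; the bit of the pair `u < v` has the index
`(v choose 2) + u`. -/
def graphOf {n : ℕ} (a : Fin (n.choose 2) → Fin 2) : SimpleGraph (Fin n) where
  Adj u v := u ≠ v ∧ ∃ e : Fin (n.choose 2),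
    (e : ℕ) = (max (u : ℕ) v).choose 2 + min (u : ℕ) v ∧ a e = 1
  symm := ⟨fun u v ⟨h, e, he, ha⟩ => ⟨h.symm, e, by rw [he, max_comm, min_comm], ha⟩⟩
  loopless := ⟨fun _ h => h.1 rfl⟩

/-- The directed graph on `n` vertices, loops being allowed, given by `n * n` bits. -/
def digraphOf {n : ℕ} (a : Fin (n * n) → Fin 2) : Digraph (Fin n) where
  Adj u v := a (finProdFinEquiv (u, v)) = 1

/-- The property `f` of bit strings (of length `len n` for each `n`) is decided in time polynomial
in `n`. -/
def DecidablePolyTime (len : ℕ → ℕ) (f : ∀ n, (Fin (len n) → Fin 2) → Prop) : Prop :=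
  ∃ (c : Cmd) (p : Polynomial ℕ), ∀ n : ℕ, 0 < n → ∀ a : Fin (len n) → Fin 2,
    ∃ (t : ℕ) (r : Dat),
      Computes noOracle c (.cons (Dat.ofNat n) (Dat.ofTuple a)) r t ∧
        t ≤ p.eval n ∧ (r ≠ .nil ↔ f n a)

/-- For an increasing `f`: find a minimal bit string with the property `f` that avoids the positions
named by the constraints. -/
def increasingCSP (len : ℕ → ℕ) (f : ∀ n, (Fin (len n) → Fin 2) → Prop) : CSP where
  w _ := 2
  len := len
  q _ := 1
  W n := {a | Minimal (f n) a}
  rels _ := {negRel}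

/-- For a decreasing `f`: find a maximal bit string with the property `f` that contains the positions
named by the constraints. -/
def decreasingCSP (len : ℕ → ℕ) (f : ∀ n, (Fin (len n) → Fin 2) → Prop) : CSP where
  w _ := 2
  len := len
  q _ := 1
  W n := {a | Maximal (f n) a}
  rels _ := {idRel}

/-- Equality to a member of a class `K` of graphs: each constraint requires some pair of vertices to
be an edge, or not to be an edge. -/
def equalityCSP (K : ∀ n, Set (SimpleGraph (Fin n))) : CSP where
  w _ := 2
  len n := n.choose 2
  q _ := 1
  W n := {a | graphOf a ∈ K n}
  rels _ := {idRel, negRel}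

/-- Equality to a spanning tree. -/
def equalitySpanningTree : CSP := equalityCSP fun _ => {G | G.IsTree}

end HiddenCSP

open HiddenCSP

namespace HiddenCSP

/-! ### Functions computable in polynomial time -/

/-! All parts follow one learning scheme, `hiddenPolyTime_of_learner`. The state records facts that
every satisfying admissible assignment must obey, together with an admissible proposal compatible
with them. A disclosed violation yields a new fact and thereby lowers a rank bounded by a polynomial
in `n`; when no admissible assignment fits the recorded facts, NO is correct. Neither `m` nor the
index of the violated constraint is needed.

Binary Boolean constraints: the relation stays hidden, but the two values seen by a violated
constraint form a forbidden pattern. There are at most `4 n²` patterns, and the recorded ones form a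
2-SAT formula satisfied by the current proposal `a`. A solution must differ from `a` at one of the
two disclosed variables. `repair` flips one of them and propagates. A recorded pattern that has
become matched was not matched by `a`, so it involves a flipped variable; if the other one is not
flipped yet, it has to be, and if both are flipped, no solution differs from `a` at the first
flipped variable (`Repairing.step`, `repair_spec`). If both choices fail, there is no solution.
Unique games with two letters are a special case.

Monotone properties: a violation discloses a position that must carry a fixed letter. By
monotonicity, an extremal string with the letter at all recorded positions exists if and only if the
string with the letter at exactly these positions has the property, and a greedy pass then finds one
(`BitInput.greedy_spec`).

Spanning trees: a wrongly chosen pair becomes excluded, a wrongly omitted one required. Kruskal's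
algorithm, run first on the required pairs and then on the allowed ones, finds a tree between the
two sets whenever one exists (`forestCheck_of_isTree`).

To turn these procedures into programs, `PolyFun` collects functions computable in time polynomial
in the height of the encoding. Height equals the value of a unary number and bounds the length of a
list, hence the number of rounds of a loop over it. The class is closed under composition, pairing,
case distinction, and folds whose accumulators stay polynomially high. -/

theorem eval_mono (p : Polynomial ℕ) {a b : ℕ} (h : a ≤ b) : p.eval a ≤ p.eval b := by
  rw [Polynomial.eval_eq_sum_range, Polynomial.eval_eq_sum_range]
  exact Finset.sum_le_sum fun i _ => Nat.mul_le_mul_left _ (Nat.pow_le_pow_left h i)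

/-! ### Encodings and their heights. -/

def Dat.height : Dat → ℕ
  | .nil => 0
  | .cons a b => max a.height b.height + 1

/-- Types whose elements are represented by values of the machine model. -/
class Enc (α : Type) where
  enc : α → Dat

open HiddenCSP.Enc (enc)

def Dat.ofBool : Bool → Dat
  | false => .nil
  | true => .cons .nil .nil

instance : Enc Bool := ⟨Dat.ofBool⟩
instance : Enc ℕ := ⟨Dat.ofNat⟩
instance {α β : Type} [Enc α] [Enc β] : Enc (α × β) := ⟨fun x => .cons (enc x.1) (enc x.2)⟩
instance {α : Type} [Enc α] : Enc (List α) := ⟨fun l => Dat.ofList (l.map enc)⟩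
instance {α : Type} [Enc α] : Enc (Option α) :=
  ⟨fun x => x.elim .nil fun a => .cons .nil (enc a)⟩
instance {α : Type} [Enc α] {p : α → Prop} : Enc (Subtype p) := ⟨fun x => enc x.1⟩

section
variable {α β : Type} [Enc α] [Enc β]

theorem enc_false : enc false = Dat.nil := rfl
theorem enc_true : enc true = Dat.cons .nil .nil := rfl
theorem enc_zero : enc 0 = Dat.nil := rfl
theorem enc_succ (n : ℕ) : enc (n + 1) = Dat.cons .nil (enc n) := rfl
theorem enc_pair (a : α) (b : β) : enc (a, b) = Dat.cons (enc a) (enc b) := rfl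
theorem enc_nil : enc ([] : List α) = Dat.nil := rfl
theorem enc_cons (a : α) (l : List α) : enc (a :: l) = Dat.cons (enc a) (enc l) := rfl
theorem enc_none : enc (none : Option α) = Dat.nil := rfl
theorem enc_some (a : α) : enc (some a) = Dat.cons .nil (enc a) := rfl

theorem height_pair (a : α) (b : β) :
    (enc (a, b)).height = max (enc a).height (enc b).height + 1 := rfl

theorem height_bool (b : Bool) : (enc b).height ≤ 1 := by cases b <;> decide

theorem height_nat (n : ℕ) : (enc n).height = n := by
  induction n with
  | zero => rfl
  | succ n ih => rw [enc_succ, Dat.height, ih]; simp [Dat.height]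

theorem length_le_height (l : List α) : l.length ≤ (enc l).height := by
  induction l with
  | nil => simp
  | cons a l ih => rw [enc_cons, Dat.height, List.length_cons]; omega

theorem height_mem {a : α} {l : List α} (h : a ∈ l) : (enc a).height ≤ (enc l).height := by
  induction l with
  | nil => simp at h
  | cons b l ih =>
    rw [enc_cons, Dat.height]
    rcases List.mem_cons.1 h with rfl | h
    · omega
    · have := ih h; omega

/-- Each cons cell adds one level, so a list costs its length on top of its highest entry, not the
sum of the heights of its entries. -/
theorem height_list_le {l : List α} {B : ℕ} (h : ∀ a ∈ l, (enc a).height ≤ B) :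
    (enc l).height ≤ B + l.length := by
  induction l with
  | nil => rw [enc_nil]; simp [Dat.height]
  | cons a l ih =>
    rw [enc_cons, Dat.height, List.length_cons]
    have h1 := h a (by simp)
    have h2 := ih fun b hb => h b (by simp [hb])
    omega

theorem height_listBool_le (l : List Bool) : (enc l).height ≤ l.length + 1 := by
  have := height_list_le (l := l) fun a _ => height_bool a
  omega

end

/-- Whatever the oracle is, `c` started in `σ` halts without any query after at most `T` steps in a
store satisfying `P`. -/
def Run (c : Cmd) (σ : Store) (T : ℕ) (P : Store → Prop) : Prop :=
  ∀ (O : Oracle) (k : ℕ), ∃ (σ' : Store) (t : ℕ), Exec O c σ k σ' k t ∧ t ≤ T ∧ P σ'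

/-! ### Time-bounded execution rules for the program constructs. -/

namespace Run

variable {c d : Cmd} {σ : Store} {T T' : ℕ} {P Q : Store → Prop} {e : Expr}

theorem mono (h : Run c σ T P) (hT : T ≤ T') (hP : ∀ σ', P σ' → Q σ') : Run c σ T' Q :=
  fun O k => by
    obtain ⟨σ', t, h1, h2, h3⟩ := h O k
    exact ⟨σ', t, h1, h2.trans hT, hP _ h3⟩

theorem assign {x : ℕ} (h : P (Function.update σ x (e.eval σ))) : Run (.assign x e) σ 1 P :=
  fun _ _ => ⟨_, _, .assign .., le_rfl, h⟩

theorem seq (h : Run c σ T P) (h' : ∀ σ', P σ' → Run d σ' T' Q) :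
    Run (.seq c d) σ (T + T') Q := fun O k => by
  obtain ⟨σ', t, h1, h2, h3⟩ := h O k
  obtain ⟨σ'', t', h1', h2', h3'⟩ := h' _ h3 O k
  exact ⟨σ'', t + t', h1.seq h1', by omega, h3'⟩

theorem assign_seq {x : ℕ} (h : Run d (Function.update σ x (e.eval σ)) T P) :
    Run (.seq (.assign x e) d) σ (T + 1) P := by
  have := seq (P := fun σ' => σ' = Function.update σ x (e.eval σ)) (assign (σ := σ) (e := e) (x := x) rfl)
    (fun σ' hσ' => by rw [hσ']; exact h)
  exact this.mono (by omega) fun _ h => h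

theorem ite_true (he : e.eval σ ≠ .nil) (h : Run c σ T P) : Run (.ite e c d) σ (T + 1) P :=
  fun O k => by
    obtain ⟨σ', t, h1, h2, h3⟩ := h O k
    exact ⟨σ', _, .ite_true he h1, by omega, h3⟩

theorem ite_false (he : e.eval σ = .nil) (h : Run d σ T P) : Run (.ite e c d) σ (T + 1) P :=
  fun O k => by
    obtain ⟨σ', t, h1, h2, h3⟩ := h O k
    exact ⟨σ', _, .ite_false he h1, by omega, h3⟩

theorem loop_done (he : e.eval σ = .nil) (h : P σ) : Run (.loop e c) σ 1 P :=
  fun _ _ => ⟨σ, _, .loop_done he, le_rfl, h⟩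

theorem loop_step (he : e.eval σ ≠ .nil) (h : Run c σ T P)
    (h' : ∀ σ', P σ' → Run (.loop e c) σ' T' Q) : Run (.loop e c) σ (T + T' + 1) Q :=
  fun O k => by
    obtain ⟨σ', t, h1, h2, h3⟩ := h O k
    obtain ⟨σ'', t', h1', h2', h3'⟩ := h' _ h3 O k
    exact ⟨σ'', _, .loop_step he h1 h1', by omega, h3'⟩

end Run

/-- `c` computes `f` in the variable `0`, changes only variables below `N`, and both its running
time and the height of its result are bounded by the value of `p` at the height of the argument. -/
def Realizes {α β : Type} [Enc α] [Enc β] (f : α → β) (c : Cmd) (N : ℕ) (p : Polynomial ℕ) : Prop :=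
  0 < N ∧ ∀ a, (∀ σ : Store, σ 0 = enc a →
    Run c σ (p.eval (enc a).height)
      fun σ' => σ' 0 = enc (f a) ∧ ∀ x, N ≤ x → σ' x = σ x) ∧
    (enc (f a)).height ≤ p.eval (enc a).height

/-- `f` is computed by a program in time polynomial in the height of the argument. -/
def PolyFun {α β : Type} [Enc α] [Enc β] (f : α → β) : Prop :=
  ∃ c N p, Realizes f c N p

def Dat.quote : Dat → Expr
  | .nil => .nil
  | .cons a b => .cons a.quote b.quote

theorem Dat.eval_quote (d : Dat) (σ : Store) : d.quote.eval σ = d := by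
  induction d with
  | nil => rfl
  | cons a b iha ihb => simp [Dat.quote, Expr.eval, iha, ihb]

/-! ### Closure properties of the polynomial-time functions. -/

namespace PolyFun

variable {α β γ δ : Type} [Enc α] [Enc β] [Enc γ] [Enc δ]

theorem of_expr {f : α → β} (e : Expr) (C : ℕ) (he : ∀ a σ, σ 0 = enc a → e.eval σ = enc (f a))
    (hC : ∀ a, (enc (f a)).height ≤ (enc a).height + C) : PolyFun f := by
  refine ⟨.assign 0 e, 1, Polynomial.X + Polynomial.C (C + 1), one_pos, fun a => ⟨fun σ h => ?_, ?_⟩⟩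
  · refine (Run.assign ⟨?_, fun x hx => ?_⟩).mono (T := 1) ?_ fun _ h => h
    · simp; omega
    · simp [he a σ h]
    · rw [Function.update_of_ne (by omega)]
  · have := hC a
    simp; omega

/-- Only the values on encodings matter. -/
theorem congr_enc {α' β' : Type} [Enc α'] [Enc β'] {f : α → β} {g : α' → β'} (hf : PolyFun f)
    (i : α' → α) (hi : ∀ a, enc (i a) = enc a) (h : ∀ a, enc (g a) = enc (f (i a))) :
    PolyFun g := by
  obtain ⟨c, N, p, hN, hc⟩ := hf
  refine ⟨c, N, p, hN, fun a => ?_⟩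
  have := hc (i a)
  rw [hi, ← h] at this
  exact this

theorem of_eq {f g : α → β} (hf : PolyFun f) (h : ∀ a, f a = g a) : PolyFun g := by
  rwa [← funext h]

protected theorem id : PolyFun fun a : α => a := of_expr (.var 0) 0 (fun _ _ h => h) (by simp)

protected theorem const (b : β) : PolyFun fun _ : α => b :=
  of_expr (enc b).quote (enc b).height (fun _ _ _ => Dat.eval_quote _ _) (by simp)

theorem fst : PolyFun fun x : α × β => x.1 :=
  of_expr (.head (.var 0)) 0 (fun a σ h => by simp [Expr.eval, h]; rfl)
    (fun ⟨a, b⟩ => by rw [height_pair]; simp only; omega)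

theorem snd : PolyFun fun x : α × β => x.2 :=
  of_expr (.tail (.var 0)) 0 (fun a σ h => by simp [Expr.eval, h]; rfl)
    (fun ⟨a, b⟩ => by rw [height_pair]; simp only; omega)

theorem cons : PolyFun fun x : α × List α => x.1 :: x.2 :=
  of_expr (.var 0) 0 (fun _ _ h => h) (fun _ => le_rfl)

theorem succ : PolyFun fun n : ℕ => n + 1 :=
  of_expr (.cons .nil (.var 0)) 1 (fun a σ h => by simp [Expr.eval, h]; rfl)
    (fun a => by simp [height_nat])

theorem some : PolyFun fun a : α => some a :=
  of_expr (.cons .nil (.var 0)) 1 (fun a σ h => by simp [Expr.eval, h]; rfl)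
    (fun a => by rw [enc_some]; simp [Dat.height])

theorem tail : PolyFun fun l : List α => l.tail :=
  of_expr (.tail (.var 0)) 0 (fun a σ h => by cases a <;> simp [Expr.eval, h] <;> rfl)
    (fun a => by cases a <;> simp [enc_cons, enc_nil, Dat.height]; omega)

/-- The head of `nil` is `nil`, so no test for emptiness is needed when the default value is encoded
by `nil`. -/
theorem headD (d : α) (hd : enc d = .nil) : PolyFun fun l : List α => l.headD d :=
  of_expr (.head (.var 0)) 0
    (fun a σ h => by cases a <;> simp [Expr.eval, h, hd] <;> rfl)
    (fun a => by cases a <;> simp [enc_cons, hd, Dat.height]; omega)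

theorem not : PolyFun fun b : Bool => !b := by
  refine ⟨.ite (.var 0) (.assign 0 .nil) (.assign 0 (.cons .nil .nil)), 1, 2, one_pos,
    fun a => ⟨fun σ h => ?_, ?_⟩⟩
  · cases a
    · refine (Run.ite_false (by simp [Expr.eval, h, enc_false])
        (Run.assign ⟨?_, fun x hx => ?_⟩)).mono (T := 2) ?_ fun _ h => h
      · simp
      · simp [Expr.eval, enc_true]
      · rw [Function.update_of_ne (by omega)]
    · refine (Run.ite_true (by simp [Expr.eval, h, enc_true])
        (Run.assign ⟨?_, fun x hx => ?_⟩)).mono (T := 2) ?_ fun _ h => h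
      · simp
      · simp [Expr.eval, enc_false]
      · rw [Function.update_of_ne (by omega)]
  · have := height_bool !a
    simp; omega

theorem comp {g : β → γ} {f : α → β} (hg : PolyFun g) (hf : PolyFun f) :
    PolyFun fun a => g (f a) := by
  obtain ⟨cf, Nf, pf, hNf, hcf⟩ := hf
  obtain ⟨cg, Ng, pg, hNg, hcg⟩ := hg
  refine ⟨.seq cf cg, max Nf Ng, pf + pg.comp pf, by omega, fun a => ⟨fun σ h => ?_, ?_⟩⟩
  · have h1 := (hcf a).1 σ h
    have h2 : pg.eval (enc (f a)).height ≤ pg.eval (pf.eval (enc a).height) :=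
      eval_mono pg (hcf a).2
    refine Run.mono (h1.seq fun σ' h' => ((hcg (f a)).1 σ' h'.1).mono h2 fun σ'' h'' =>
      (⟨h''.1, fun x hx => by rw [h''.2 x (by omega), h'.2 x (by omega)]⟩ :
        _ ∧ ∀ x, max Nf Ng ≤ x → σ'' x = σ x)) (by simp) fun _ h => h
  · have h1 := (hcg (f a)).2
    have h2 : pg.eval (enc (f a)).height ≤ pg.eval (pf.eval (enc a).height) :=
      eval_mono pg (hcf a).2
    simp; omega

theorem pair {f : α → β} {g : α → γ} (hf : PolyFun f) (hg : PolyFun g) :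
    PolyFun fun a => (f a, g a) := by
  obtain ⟨cf, Nf, pf, hNf, hcf⟩ := hf
  obtain ⟨cg, Ng, pg, hNg, hcg⟩ := hg
  obtain ⟨N, hN⟩ : ∃ N, N = max Nf Ng := ⟨_, rfl⟩
  -- Both programs leave the variables from `N` on untouched, so `N` can keep the argument and `N +
  -- 1` the value of `f`. The constant 4 counts the assignments.
  refine ⟨.seq (.assign N (.var 0)) (.seq cf (.seq (.assign (N + 1) (.var 0))
    (.seq (.assign 0 (.var N)) (.seq cg (.assign 0 (.cons (.var (N + 1)) (.var 0))))))),
    N + 2, pf + pg + 4, by omega, fun a => ⟨fun σ h => ?_, ?_⟩⟩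
  · have h0 : N ≠ 0 := by omega
    refine (Run.assign_seq (Run.seq ((hcf a).1 _ ?_) fun σ1 h1 => Run.assign_seq
      (Run.assign_seq (Run.seq ((hcg a).1 _ ?_) fun σ2 h2 =>
        Run.assign ⟨?_, fun x hx => ?_⟩)))).mono ?_ fun _ h => h
    · rw [Function.update_of_ne (by omega), h]
    · have := h1.2 N (by omega)
      simp [Expr.eval, this, h]
    · simp; omega
    · have := h2.2 (N + 1) (by omega)
      simp [Expr.eval, this, h2.1, h1.1, enc_pair]
    · rw [Function.update_of_ne (by omega), h2.2 x (by omega), Function.update_of_ne (by omega),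
        Function.update_of_ne (by omega), h1.2 x (by omega), Function.update_of_ne (by omega)]
  · have h1 := (hcf a).2
    have h2 := (hcg a).2
    rw [height_pair]
    simp; omega

theorem cond {b : α → Bool} {f g : α → β} (hb : PolyFun b) (hf : PolyFun f) (hg : PolyFun g) :
    PolyFun fun a => if b a then f a else g a := by
  obtain ⟨cb, Nb, pb, hNb, hcb⟩ := hb
  obtain ⟨cf, Nf, pf, hNf, hcf⟩ := hf
  obtain ⟨cg, Ng, pg, hNg, hcg⟩ := hg
  obtain ⟨N, hN⟩ : ∃ N, N = max Nb (max Nf Ng) := ⟨_, rfl⟩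
  refine ⟨.seq (.assign N (.var 0)) (.seq cb (.ite (.var 0) (.seq (.assign 0 (.var N)) cf)
    (.seq (.assign 0 (.var N)) cg))),
    N + 1, pb + pf + pg + 3, by omega, fun a => ⟨fun σ h => ?_, ?_⟩⟩
  · have h0 : N ≠ 0 := by omega
    refine (Run.assign_seq (Run.seq (T' := pf.eval (enc a).height + pg.eval (enc a).height + 2)
      ((hcb a).1 _ ?_) fun σ1 h1 => ?_)).mono ?_ fun _ h => h
    · rw [Function.update_of_ne (by omega), h]
    · have hn := h1.2 N (by omega)
      cases hba : b a
      · refine (Run.ite_false (by simp [Expr.eval, h1.1, hba, enc_false]) (Run.assign_seq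
          ((hcg a).1 _ ?_))).mono (by omega) fun σ2 h2 => ⟨?_, fun x hx => ?_⟩
        · simp [Expr.eval, hn, h]
        · simp [h2.1, hba]
        · rw [h2.2 x (by omega), Function.update_of_ne (by omega), h1.2 x (by omega),
            Function.update_of_ne (by omega)]
      · refine (Run.ite_true (by simp [Expr.eval, h1.1, hba, enc_true]) (Run.assign_seq
          ((hcf a).1 _ ?_))).mono (by omega) fun σ2 h2 => ⟨?_, fun x hx => ?_⟩
        · simp [Expr.eval, hn, h]
        · simp [h2.1, hba]
        · rw [h2.2 x (by omega), Function.update_of_ne (by omega), h1.2 x (by omega),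
            Function.update_of_ne (by omega)]
    · simp; omega
  · have h1 := (hcf a).2
    have h2 := (hcg a).2
    simp only [Polynomial.eval_add]
    split <;> omega

/-- The test whether a result is `nil`. -/
theorem test {f : α → β} (hf : PolyFun f) {b : α → Bool}
    (h : ∀ a, enc (f a) = .nil ↔ b a = false) : PolyFun b := by
  obtain ⟨c, N, p, hN, hc⟩ := hf
  refine ⟨.seq c (.ite (.var 0) (.assign 0 (.cons .nil .nil)) (.assign 0 .nil)), N, p + 2, hN,
    fun a => ⟨fun σ hσ => ?_, ?_⟩⟩
  · refine (Run.seq (T' := 2) ((hc a).1 σ hσ) fun σ1 h1 => ?_).mono (by simp) fun _ h => h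
    cases hb : b a
    · refine Run.ite_false (by simp [Expr.eval, h1.1, (h a).2 hb]) (Run.assign ⟨?_, fun x hx => ?_⟩)
      · simp [Expr.eval, enc_false]
      · rw [Function.update_of_ne (by omega), h1.2 x hx]
    · have : enc (f a) ≠ .nil := fun h' => by simp [(h a).1 h'] at hb
      refine Run.ite_true (by simp [Expr.eval, h1.1, this]) (Run.assign ⟨?_, fun x hx => ?_⟩)
      · simp [Expr.eval, enc_true]
      · rw [Function.update_of_ne (by omega), h1.2 x hx]
  · have := height_bool (b a)
    simp; omega

/-- In the loop, `N` holds the parameter, `N + 1` the unread entries and `0` the accumulator. If `H`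
bounds the heights of the parameter, the list and all accumulators, then every argument of `f` has
height at most `H + 2`; a round costs one call and three further steps. -/
theorem run_loop_foldl {f : γ × β × α → β} {c : Cmd} {N : ℕ} {p : Polynomial ℕ}
    (hc : Realizes f c N p) (x : γ) (H : ℕ) (hx : (enc x).height ≤ H) (l : List α) :
    ∀ (b : β), (enc l).height ≤ H →
      (∀ l', l' <+: l → (enc (l'.foldl (fun b a => f (x, b, a)) b)).height ≤ H) →
      ∀ σ : Store, σ 0 = enc b → σ N = enc x → σ (N + 1) = enc l →
        Run (.loop (.var (N + 1)) (.seq (.assign 0 (.cons (.var N) (.cons (.var 0)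
            (.head (.var (N + 1)))))) (.seq c (.assign (N + 1) (.tail (.var (N + 1)))))))
          σ (l.length * (p.eval (H + 2) + 3) + 1)
          fun σ' => σ' 0 = enc (l.foldl (fun b a => f (x, b, a)) b) ∧
            ∀ y, N + 2 ≤ y → σ' y = σ y := by
  have hN := hc.1
  induction l with
  | nil =>
    intro b _ _ σ h0 _ h2
    exact (Run.loop_done (by simp [Expr.eval, h2, enc_nil]) ⟨h0, fun _ _ => rfl⟩).mono
      (by simp) fun _ h => h
  | cons a l ih =>
    intro b hl hb σ h0 h1 h2
    have hb0 : (enc b).height ≤ H := hb [] (by simp)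
    rw [enc_cons, Dat.height] at hl
    have hh : (enc (x, b, a)).height ≤ H + 2 := by
      rw [height_pair, height_pair]; omega
    refine (Run.loop_step (T := p.eval (H + 2) + 2) (T' := l.length * (p.eval (H + 2) + 3) + 1)
      (P := fun σ' => σ' 0 = enc (f (x, b, a)) ∧ σ' N = enc x ∧ σ' (N + 1) = enc l ∧
        ∀ y, N + 2 ≤ y → σ' y = σ y) ?_ ?_ fun σ1 g => ?_).mono ?_ fun _ h => h
    · simp [Expr.eval, h2, enc_cons]
    · refine (Run.assign_seq (((hc.2 (x, b, a)).1 _ ?_).seq fun σ1 g => Run.assign ?_)).mono ?_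
        fun _ h => h
      · simp [Expr.eval, h0, h1, h2, enc_pair, enc_cons, Dat.head]
      · have e1 := g.2 N le_rfl
        have e2 := g.2 (N + 1) (by omega)
        rw [Function.update_of_ne (by omega)] at e1 e2
        refine ⟨?_, ?_, ?_, fun y hy => ?_⟩
        · rw [Function.update_of_ne (by omega), g.1]
        · rw [Function.update_of_ne (by omega), e1, h1]
        · simp [Expr.eval, e2, h2, enc_cons, Dat.tail]
        · rw [Function.update_of_ne (by omega), g.2 y (by omega), Function.update_of_ne (by omega)]
      · have := eval_mono p hh
        omega
    · refine (ih (f (x, b, a)) (by omega) (fun l' hl' => ?_) σ1 g.1 g.2.1 g.2.2.1).mono le_rfl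
        fun σ2 g2 => ⟨g2.1, fun y hy => by rw [g2.2 y hy, g.2.2.2 y hy]⟩
      exact hb (a :: l') (by simpa using hl')
    · rw [List.length_cons, add_mul]
      omega

/-- The hypothesis `hq` does not follow from `hf`: iterating a function of polynomial growth, such
as doubling, may produce exponentially large values. All prefixes occur because every intermediate
accumulator is an argument of `f`. -/
theorem foldl {f : γ × β × α → β} (hf : PolyFun f) (q : Polynomial ℕ)
    (hq : ∀ x b l l', l' <+: l → (enc (l'.foldl (fun b a => f (x, b, a)) b)).height ≤
      q.eval (enc (x, b, l)).height) :
    PolyFun fun y : γ × β × List α => y.2.2.foldl (fun b a => f (y.1, b, a)) y.2.1 := by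
  obtain ⟨c, N, p, hc⟩ := hf
  have hN := hc.1
  -- For an argument of height `h`, the loop is run with `H = q(h) + h` and has at most `h` rounds.
  -- The 4 pays for three assignments and the last test, and the summand `q` bounds the height of
  -- the result.
  refine ⟨.seq (.assign N (.head (.var 0))) (.seq (.assign (N + 1) (.tail (.tail (.var 0))))
      (.seq (.assign 0 (.head (.tail (.var 0))))
      (.loop (.var (N + 1)) (.seq (.assign 0 (.cons (.var N) (.cons (.var 0)
        (.head (.var (N + 1)))))) (.seq c (.assign (N + 1) (.tail (.var (N + 1))))))))),
    N + 2, Polynomial.X * (p.comp (q + Polynomial.X + 2) + 3) + 4 + q, by omega,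
    fun ⟨x, b, l⟩ => ⟨fun σ h => ?_, ?_⟩⟩
  · have hh : (enc (x, b, l)).height = max (enc x).height (max (enc b).height (enc l).height + 1) + 1 :=
      rfl
    refine (Run.assign_seq (Run.assign_seq (Run.assign_seq
      (run_loop_foldl hc x (q.eval (enc (x, b, l)).height + (enc (x, b, l)).height) ?_ l b ?_ ?_ _
        ?_ ?_ ?_)))).mono ?_ fun σ' g => ⟨g.1, fun y hy => ?_⟩
    · omega
    · omega
    · intro l' hl'
      exact (hq x b l l' hl').trans (by omega)
    · simp [Expr.eval, h, hN.ne, enc_pair, Dat.head, Dat.tail]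
    · simp [Expr.eval, h, hN.ne', enc_pair, Dat.head]
    · simp [Expr.eval, h, hN.ne, enc_pair, Dat.tail]
    · have h1 := length_le_height l
      have h2 : l.length ≤ (enc (x, b, l)).height := by omega
      have := Nat.mul_le_mul_right (p.eval (q.eval (enc (x, b, l)).height + (enc (x, b, l)).height + 2) + 3) h2
      simp
      omega
    · rw [g.2 y hy, Function.update_of_ne (by omega), Function.update_of_ne (by omega),
        Function.update_of_ne (by omega)]
  · have := hq x b l l (List.prefix_refl l)
    simp
    omega

end PolyFun

/-! ### Polynomial-time arithmetic and list operations. -/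

namespace PolyFun

variable {α β γ δ : Type} [Enc α] [Enc β] [Enc γ] [Enc δ]

theorem comp₂ {f : β × γ → δ} {g : α → β} {h : α → γ} (hf : PolyFun f) (hg : PolyFun g)
    (hh : PolyFun h) : PolyFun fun a => f (g a, h a) := hf.comp (hg.pair hh)

/-! #### Booleans -/

theorem and {f g : α → Bool} (hf : PolyFun f) (hg : PolyFun g) : PolyFun fun a => f a && g a :=
  (hf.cond hg (.const false)).of_eq fun a => by cases f a <;> rfl

theorem beq {f g : α → Bool} (hf : PolyFun f) (hg : PolyFun g) : PolyFun fun a => f a == g a :=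
  (hf.cond hg (PolyFun.not.comp hg)).of_eq fun a => by cases f a <;> cases g a <;> rfl

/-! #### Iteration -/

theorem enc_replicate_false (n : ℕ) : enc (List.replicate n false) = enc n := by
  induction n with
  | zero => rfl
  | succ n ih => rw [List.replicate_succ, enc_cons, ih]; rfl

theorem replicate_false : PolyFun fun n : ℕ => List.replicate n false :=
  (PolyFun.id (α := ℕ)).congr_enc (fun n => n) (fun _ => rfl) enc_replicate_false

theorem foldl_const {α β : Type} (f : α → α) (l : List β) (a : α) :
    l.foldl (fun a _ => f a) a = f^[l.length] a := by
  induction l generalizing a with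
  | nil => rfl
  | cons b l ih => rw [List.foldl_cons, ih]; rfl

theorem iterate {f : α → α} (hf : PolyFun f) (q : Polynomial ℕ)
    (hq : ∀ n a i, i ≤ n → (enc (f^[i] a)).height ≤ q.eval (enc (n, a)).height) :
    PolyFun fun x : ℕ × α => f^[x.1] x.2 := by
  -- A unary number is encoded by the same value as a list of copies of `false`, so counting is
  -- folding over such a list.
  have h := foldl (f := fun x : Bool × α × Bool => f x.2.1) (hf.comp (fst.comp snd)) q ?_
  · refine (h.comp ((PolyFun.const false).pair (snd.pair (replicate_false.comp fst)))).of_eq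
      fun x => ?_
    simp only
    rw [foldl_const, List.length_replicate]
  · intro _ b l l' hl'
    simp only
    rw [foldl_const]
    refine (hq l.length b _ hl'.length_le).trans (eval_mono q ?_)
    have := length_le_height l
    simp only [height_pair, height_nat]
    omega

theorem drop : PolyFun fun x : ℕ × List α => x.2.drop x.1 := by
  have key : ∀ (n : ℕ) (l : List α), List.tail^[n] l = l.drop n := by
    intro n
    induction n with
    | zero => simp
    | succ n ih => intro l; rw [Function.iterate_succ_apply, ih]; simp
  refine (iterate (f := List.tail (α := α)) tail .X ?_).of_eq fun x => key _ _
  intro n a i _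
  have : (enc (List.tail^[i] a)).height ≤ (enc a).height := by
    rw [key]
    clear key
    induction i generalizing a with
    | zero => simp
    | succ i ih =>
      cases a with
      | nil => simp
      | cons b l => rw [List.drop_succ_cons, enc_cons, Dat.height]; have := ih l (by omega); omega
  rw [Polynomial.eval_X, height_pair]
  omega

theorem getD (d : α) (hd : enc d = .nil) : PolyFun fun x : ℕ × List α => x.2.getD x.1 d :=
  ((headD d hd).comp drop).of_eq fun x => by
    simp [List.headD_eq_head?_getD, List.getD_eq_getElem?_getD]

/-! #### Natural numbers -/

/-- With `n` identified with `n` copies of `false`, dropping entries is truncated subtraction. -/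
theorem sub : PolyFun fun x : ℕ × ℕ => x.2 - x.1 :=
  (drop (α := Bool)).congr_enc (fun x => (x.1, List.replicate x.2 false))
    (fun x => by simp only [enc_pair, enc_replicate_false]; rfl)
    (fun x => by simp [enc_replicate_false])

theorem decide_eq : PolyFun fun x : ℕ × ℕ => decide (x.1 = x.2) := by
  have h : PolyFun fun n : ℕ => decide (n ≠ 0) := PolyFun.id.test fun n => by
    cases n <;> simp [enc_zero, enc_succ]
  -- Two numbers are equal if and only if both truncated differences vanish.
  refine ((h.comp sub).cond (.const false) ((h.comp (sub.comp₂ snd fst)).cond (.const false)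
    (.const true))).of_eq fun x => ?_
  simp only [decide_eq_true_eq]
  split_ifs <;> simp <;> omega

theorem add : PolyFun fun x : ℕ × ℕ => x.1 + x.2 := by
  have key : ∀ i a : ℕ, (fun n => n + 1)^[i] a = i + a := by
    intro i a
    induction i with
    | zero => simp
    | succ i ih => rw [Function.iterate_succ_apply', ih]; omega
  refine (iterate succ (2 * .X) ?_).of_eq fun x => key _ _
  intro n a i hi
  simp [key, height_nat, height_pair]
  omega

theorem mul_self : PolyFun fun n : ℕ => n * n := by
  have key : ∀ i a b : ℕ, (fun x : ℕ × ℕ => (x.1, x.2 + x.1))^[i] (a, b) = (a, b + i * a) := by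
    intro i a b
    induction i with
    | zero => simp
    | succ i ih => rw [Function.iterate_succ_apply', ih]; simp; ring
  refine (snd.comp ((iterate (f := fun x : ℕ × ℕ => (x.1, x.2 + x.1))
    (fst.pair (add.comp₂ snd fst)) (2 * .X + .X * .X + 1) ?_).comp
    (PolyFun.id.pair (PolyFun.id.pair (.const 0))))).of_eq fun n => ?_
  · rintro n ⟨a, b⟩ i hi
    rw [key]
    simp only [height_nat, height_pair, Polynomial.eval_add, Polynomial.eval_mul,
      Polynomial.eval_X, Polynomial.eval_ofNat, Polynomial.eval_one]
    have : i * a ≤ (max n (max a b + 1) + 1) * (max n (max a b + 1) + 1) :=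
      Nat.mul_le_mul (by omega) (by omega)
    omega
  · rw [key]; simp

/-- The iteration computes `0 + 1 + ⋯ + (n - 1)`. Its closed form is needed for every starting pair,
because `iterate` requires a growth bound at every argument. -/
theorem choose_two : PolyFun fun n : ℕ => n.choose 2 := by
  have key : ∀ i a b : ℕ, (fun x : ℕ × ℕ => (x.1 + 1, x.2 + x.1))^[i] (a, b) =
      (a + i, b + i * a + i.choose 2) := by
    intro i a b
    induction i with
    | zero => simp
    | succ i ih =>
      rw [Function.iterate_succ_apply', ih, Nat.choose_succ_succ' i 1]
      simp
      constructor <;> ring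
  refine (snd.comp ((iterate (f := fun x : ℕ × ℕ => (x.1 + 1, x.2 + x.1))
    ((succ.comp fst).pair (add.comp₂ snd fst)) (2 * .X + 2 * (.X * .X) + 1) ?_).comp
    (PolyFun.id.pair ((PolyFun.const 0).pair (.const 0))))).of_eq fun n => ?_
  · rintro n ⟨a, b⟩ i hi
    rw [key]
    simp only [height_nat, height_pair, Polynomial.eval_add, Polynomial.eval_mul,
      Polynomial.eval_X, Polynomial.eval_ofNat, Polynomial.eval_one]
    have h1 : i * a ≤ (max n (max a b + 1) + 1) * (max n (max a b + 1) + 1) :=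
      Nat.mul_le_mul (by omega) (by omega)
    have h2 : i.choose 2 ≤ (max n (max a b + 1) + 1) * (max n (max a b + 1) + 1) := by
      refine (Nat.choose_le_pow i 2).trans ?_
      rw [sq]
      exact Nat.mul_le_mul (by omega) (by omega)
    omega
  · rw [key]; simp

/-! #### Lists -/

theorem foldl_cons_map {α β : Type} (g : α → β) (l : List α) (b : List β) :
    l.foldl (fun b a => g a :: b) b = (l.map g).reverse ++ b := by
  induction l generalizing b with
  | nil => rfl
  | cons a l ih => simp [ih]

/-- Prepending during a traversal reverses the order. Taking a projection for `g` gives reversal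
itself, and reversing once more gives `map`. -/
theorem reverseMap {g : γ × α → β} (hg : PolyFun g) :
    PolyFun fun x : γ × List α => (x.2.map fun a => g (x.1, a)).reverse := by
  obtain ⟨c, N, p, hc⟩ := id hg
  have h := foldl (f := fun x : γ × List β × α => g (x.1, x.2.2) :: x.2.1)
    (cons.comp ((hg.comp (fst.pair (snd.comp snd))).pair (fst.comp snd))) (p + 3 * .X) ?_
  · refine (h.comp (fst.pair ((PolyFun.const []).pair snd))).of_eq fun x => ?_
    simp only
    rw [foldl_cons_map]
    simp
  · intro x b l l' hl'
    simp only
    rw [foldl_cons_map]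
    have hl := hl'.length_le
    have h1 := length_le_height l
    have h2 := length_le_height b
    refine (height_list_le (B := p.eval (enc (x, b, l)).height + (enc (x, b, l)).height)
      fun a ha => ?_).trans ?_
    · rw [List.mem_append, List.mem_reverse, List.mem_map] at ha
      rcases ha with ⟨a, ha, rfl⟩ | ha
      · refine ((hc.2 _).2.trans (eval_mono p ?_)).trans (Nat.le_add_right _ _)
        have := height_mem (hl'.subset ha)
        simp only [height_pair]
        omega
      · have := height_mem ha
        simp only [height_pair]
        omega
    · simp only [List.length_append, List.length_reverse, List.length_map, Polynomial.eval_add,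
        Polynomial.eval_mul, Polynomial.eval_X, Polynomial.eval_ofNat]
      have h3 : (enc (x, b, l)).height = max (enc x).height (enc (b, l)).height + 1 := rfl
      have h4 : (enc (b, l)).height = max (enc b).height (enc l).height + 1 := rfl
      omega

theorem reverse : PolyFun fun l : List α => l.reverse :=
  ((reverseMap (γ := Bool) (snd (β := α))).comp ((PolyFun.const false).pair PolyFun.id)).of_eq
    fun l => by simp

theorem map {g : γ × α → β} (hg : PolyFun g) :
    PolyFun fun x : γ × List α => x.2.map fun a => g (x.1, a) :=
  (reverse.comp (reverseMap hg)).of_eq fun x => by simp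

theorem replicate (b : Bool) : PolyFun fun n : ℕ => List.replicate n b :=
  ((map (γ := Bool) (g := fun _ : Bool × Bool => b) (.const b)).comp
    ((PolyFun.const false).pair replicate_false)).of_eq fun n => by simp

/-- One step of a traversal that replaces the entry number `i` by `v`. -/
def setStep (i : ℕ) (v : α) (s : ℕ × List α) (a : α) : ℕ × List α :=
  (s.1 + 1, (if s.1 = i then v else a) :: s.2)

/-- The counter may start at any `k` so that the induction goes through; `k > i` means that the
position to be replaced has already been passed. -/
theorem foldl_setStep {α : Type} (i : ℕ) (v : α) (l : List α) : ∀ (k : ℕ) (acc : List α),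
    l.foldl (setStep i v) (k, acc) =
      (k + l.length, (if k ≤ i then l.set (i - k) v else l).reverse ++ acc) := by
  induction l with
  | nil => intro k acc; simp
  | cons a l ih =>
    intro k acc
    rw [List.foldl_cons, setStep, ih]
    simp only
    rcases lt_trichotomy k i with h | rfl | h
    · obtain ⟨j, rfl⟩ := Nat.exists_eq_add_of_lt h
      rw [if_pos (by omega), if_neg (by omega), if_pos (by omega),
        show k + j + 1 - k = j + 1 by omega, show k + j + 1 - (k + 1) = j by omega]
      simp; omega
    · simp; omega
    · rw [if_neg (by omega), if_neg (by omega), if_neg (by omega)]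
      simp; omega

theorem set : PolyFun fun x : (ℕ × α) × List α => x.2.set x.1.1 x.1.2 := by
  have hs : PolyFun fun x : (ℕ × α) × (ℕ × List α) × α => setStep x.1.1 x.1.2 x.2.1 x.2.2 := by
    have hv : PolyFun fun x : (ℕ × α) × (ℕ × List α) × α =>
        if x.2.1.1 = x.1.1 then x.1.2 else x.2.2 :=
      ((decide_eq.comp₂ (fst.comp (fst.comp snd)) (fst.comp fst)).cond (snd.comp fst)
        (snd.comp snd)).of_eq fun x => by simp only [decide_eq_true_eq]
    exact (succ.comp (fst.comp (fst.comp snd))).pair (cons.comp₂ hv (snd.comp (fst.comp snd)))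
  have h := foldl hs (4 * .X) ?_
  · refine (reverse.comp (snd.comp (h.comp
      (fst.pair (((PolyFun.const 0).pair (.const [])).pair snd))))).of_eq fun x => ?_
    change (x.2.foldl (setStep x.1.1 x.1.2) (0, [])).2.reverse = _
    rw [foldl_setStep]
    simp
  · rintro ⟨i, v⟩ ⟨k, b⟩ l l' hl'
    change (enc (l'.foldl (setStep i v) (k, b))).height ≤ _
    rw [foldl_setStep]
    have hl := hl'.length_le
    have h1 := length_le_height l
    have h2 := length_le_height b
    have h3 : (enc ((if k ≤ i then l'.set (i - k) v else l').reverse ++ b)).height ≤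
        max (enc v).height (max (enc l).height (enc b).height) + (l'.length + b.length) := by
      refine (height_list_le (B := max (enc v).height (max (enc l).height (enc b).height))
        fun a ha => ?_).trans ?_
      · rw [List.mem_append, List.mem_reverse] at ha
        rcases ha with ha | ha
        · have : a ∈ l' ∨ a = v := by
            split_ifs at ha
            · exact List.mem_or_eq_of_mem_set ha
            · exact Or.inl ha
          rcases this with ha | rfl
          · have := height_mem (hl'.subset ha); omega
          · omega
        · have := height_mem ha; omega
      · split_ifs <;> simp
    simp only [height_pair, height_nat, Polynomial.eval_mul, Polynomial.eval_X,
      Polynomial.eval_ofNat] at *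
    omega

end PolyFun

/-! ### Running programs as subroutines -/

/-- A number above all variables of the expression. -/
def Expr.bound : Expr → ℕ
  | .var x => x + 1
  | .nil => 0
  | .cons e f => max e.bound f.bound
  | .head e => e.bound
  | .tail e => e.bound

/-- A number above all variables of the program. -/
def Cmd.bound : Cmd → ℕ
  | .assign x e => max (x + 1) e.bound
  | .query x e => max (x + 1) e.bound
  | .seq c d => max c.bound d.bound
  | .ite e c d => max e.bound (max c.bound d.bound)
  | .loop e c => max e.bound c.bound

theorem Expr.eval_congr {σ τ : Store} {N : ℕ} (h : ∀ x < N, τ x = σ x) (e : Expr)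
    (he : e.bound ≤ N) : e.eval τ = e.eval σ := by
  induction e with
  | var x => exact h x he
  | nil => rfl
  | cons e f ihe ihf =>
    simp only [Expr.bound] at he
    simp only [Expr.eval, ihe (by omega), ihf (by omega)]
  | head e ih => simp only [Expr.eval, ih he]
  | tail e ih => simp only [Expr.eval, ih he]

/-- An execution under `noOracle` contains no query, so it is valid for every oracle, and it neither
reads nor writes variables from `N` on. This allows a decision program to be called inside a
learning algorithm. -/
theorem Exec.transfer {c : Cmd} {σ σ' : Store} {k k' t N : ℕ}
    (h : Exec noOracle c σ k σ' k' t) (hN : c.bound ≤ N) (O : Oracle) (j : ℕ) :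
    ∀ τ : Store, (∀ x < N, τ x = σ x) →
      ∃ τ', Exec O c τ j τ' j t ∧ (∀ x < N, τ' x = σ' x) ∧ ∀ x, N ≤ x → τ' x = τ x := by
  induction h with
  | assign x e σ k =>
    intro τ hτ
    simp only [Cmd.bound] at hN
    refine ⟨_, .assign .., fun y hy => ?_, fun y hy => Function.update_of_ne (by omega) _ _⟩
    rw [Expr.eval_congr hτ e (by omega)]
    by_cases hyx : y = x
    · subst hyx; simp
    · rw [Function.update_of_ne hyx, Function.update_of_ne hyx, hτ y hy]
  | query x e σ k r h => exact h.elim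
  | seq _ _ ih1 ih2 =>
    intro τ hτ
    simp only [Cmd.bound] at hN
    obtain ⟨τ1, e1, g1, f1⟩ := ih1 (by omega) τ hτ
    obtain ⟨τ2, e2, g2, f2⟩ := ih2 (by omega) τ1 g1
    exact ⟨τ2, e1.seq e2, g2, fun x hx => by rw [f2 x hx, f1 x hx]⟩
  | ite_true he _ ih =>
    intro τ hτ
    simp only [Cmd.bound] at hN
    obtain ⟨τ1, e1, g1, f1⟩ := ih (by omega) τ hτ
    exact ⟨τ1, .ite_true (by rwa [Expr.eval_congr hτ _ (by omega)]) e1, g1, f1⟩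
  | ite_false he _ ih =>
    intro τ hτ
    simp only [Cmd.bound] at hN
    obtain ⟨τ1, e1, g1, f1⟩ := ih (by omega) τ hτ
    exact ⟨τ1, .ite_false (by rwa [Expr.eval_congr hτ _ (by omega)]) e1, g1, f1⟩
  | loop_done he =>
    intro τ hτ
    simp only [Cmd.bound] at hN
    exact ⟨τ, .loop_done (by rwa [Expr.eval_congr hτ _ (by omega)]), hτ, fun _ _ => rfl⟩
  | loop_step he _ _ ih1 ih2 =>
    intro τ hτ
    have hN' := hN
    simp only [Cmd.bound] at hN
    obtain ⟨τ1, e1, g1, f1⟩ := ih1 (by omega) τ hτ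
    obtain ⟨τ2, e2, g2, f2⟩ := ih2 hN' τ1 g1
    exact ⟨τ2, .loop_step (by rwa [Expr.eval_congr hτ _ (by omega)]) e1 e2, g2,
      fun x hx => by rw [f2 x hx, f1 x hx]⟩

/-- Set the variables `1, …, N` to `nil`. -/
def Cmd.clear : ℕ → Cmd
  | 0 => .assign 0 (.var 0)
  | N + 1 => .seq (Cmd.clear N) (.assign (N + 1) .nil)

theorem run_clear (σ : Store) (N : ℕ) : Run (Cmd.clear N) σ (N + 1) fun σ' =>
    (∀ x ≤ N, σ' x = Function.update (fun _ => Dat.nil) 0 (σ 0) x) ∧ ∀ x, N < x → σ' x = σ x := by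
  induction N with
  | zero =>
    refine Run.assign ⟨fun x hx => ?_, fun x hx => ?_⟩
    · obtain rfl : x = 0 := by omega
      simp [Expr.eval]
    · rw [Function.update_of_ne (by omega)]
  | succ N ih =>
    refine ih.seq fun σ1 h1 => Run.assign ⟨fun x hx => ?_, fun x hx => ?_⟩
    · by_cases hxN : x = N + 1
      · subst hxN; simp [Expr.eval]
      · rw [Function.update_of_ne hxN, h1.1 x (by omega)]
    · rw [Function.update_of_ne (by omega), h1.2 x (by omega)]

/-- A function with values in `Bool` that is decided by a program is computable in polynomial
time. -/
theorem PolyFun.of_computes {α : Type} [Enc α] {f : α → Bool} (c : Cmd) (p : Polynomial ℕ)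
    (h : ∀ a, ∃ t r, Computes noOracle c (enc a) r t ∧ t ≤ p.eval (enc a).height ∧
      (r ≠ .nil ↔ f a = true)) : PolyFun f := by
  obtain ⟨N, hN⟩ : ∃ N, N = c.bound := ⟨_, rfl⟩
  -- `Computes` presupposes that all variables except the input are `nil`, whereas a subroutine may
  -- find leftovers. Clearing the variables that `c` can mention removes the difference.
  refine ⟨.seq (Cmd.clear N) (.seq c (.ite (.var 0) (.assign 0 (.cons .nil .nil)) (.assign 0 .nil))),
    N + 1, p + Polynomial.C (N + 1) + 2, by omega, fun a => ⟨fun σ hσ => ?_, ?_⟩⟩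
  · obtain ⟨t, r, ⟨σ', k, he, hr⟩, ht, hf⟩ := h a
    refine Run.mono ((run_clear σ N).seq fun σ1 h1 =>
      Run.seq (T := t) (T' := 2) (P := fun σ2 => σ2 0 = r ∧ ∀ x, N + 1 ≤ x → σ2 x = σ x)
      (fun O j => ?_) fun σ2 h2 => ?_) (T := N + 1 + (t + 2)) (by simp; omega) fun _ h => h
    · rw [hσ] at h1
      obtain ⟨τ', e1, g1, f1⟩ := he.transfer (N := N + 1) (by omega) O j σ1
        fun x hx => h1.1 x (by omega)
      exact ⟨τ', t, e1, le_rfl, by rw [g1 0 (by omega), hr], fun x hx => by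
        rw [f1 x hx, h1.2 x (by omega)]⟩
    · by_cases hr : r = .nil
      · have hfa : f a = false := by
          rw [← Bool.not_eq_true]; exact fun h => hf.2 h hr
        refine Run.ite_false (by simp [Expr.eval, h2.1, hr]) (Run.assign ⟨?_, fun x hx => ?_⟩)
        · simp [Expr.eval, hfa, enc_false]
        · rw [Function.update_of_ne (by omega), h2.2 x hx]
      · refine Run.ite_true (by simp [Expr.eval, h2.1, hr]) (Run.assign ⟨?_, fun x hx => ?_⟩)
        · simp [Expr.eval, hf.1 hr, enc_true]
        · rw [Function.update_of_ne (by omega), h2.2 x hx]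
  · have := height_bool (f a)
    simp; omega

/-! ### Learning algorithms -/

theorem enc_listNat_ofFn {k r : ℕ} (v : Fin k → Fin r) :
    enc (List.ofFn fun i => (v i : ℕ)) = Dat.ofTuple v := by
  rw [Dat.ofTuple]
  change Dat.ofList (List.map Dat.ofNat _) = _
  rw [List.map_ofFn]
  rfl

/-- A hidden problem is solved by an algorithm that keeps a state, of which the current proposal is
a part, and updates it after each answer, if every answer decreases a rank. The state `none`
means that there is no solution. -/
theorem hiddenPolyTime_of_learner {S : CSP} {τ π : Type} [Enc τ] [Enc π]
    (init : {n : ℕ // 0 < n} → Option (τ × π)) (hinit : PolyFun init)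
    (upd : (τ × π) × List ℕ → Option (τ × π)) (hupd : PolyFun upd)
    (Inv : ∀ {n m : ℕ}, S.Instance n m → ℕ → τ × π → Prop) (B q : Polynomial ℕ)
    (h_init : ∀ (n m : ℕ) (C : S.Instance n m) (hn : 0 < n),
      (init ⟨n, hn⟩ = none → ∀ a ∈ S.W n, ¬ CSP.Satisfies a C) ∧
        ∀ x, init ⟨n, hn⟩ = some x → ∃ r ≤ B.eval n, Inv C r x)
    (h_height : ∀ (n m : ℕ) (C : S.Instance n m) (r : ℕ) (x : τ × π), Inv C r x →
      (enc x).height ≤ q.eval n)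
    (h_vars : ∀ (n : ℕ) (v : Fin (S.q n) → Fin (S.len n)), (Dat.ofTuple v).height ≤ q.eval n)
    (h_step : ∀ (n m : ℕ) (C : S.Instance n m) (r : ℕ) (x : τ × π), Inv C r x →
      ∃ a ∈ S.W n, enc x.2 = Dat.ofTuple a ∧ ∀ j, ¬ (C j).Sat a →
        (upd (x, List.ofFn fun i => ((C j).vars i : ℕ)) = none →
          ∀ a ∈ S.W n, ¬ CSP.Satisfies a C) ∧
        ∀ x', upd (x, List.ofFn fun i => ((C j).vars i : ℕ)) = some x' → ∃ r' < r, Inv C r' x') :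
    S.HiddenPolyTime := by
  obtain ⟨ci, Ni, pi, hNi, hci⟩ := hinit
  obtain ⟨cu, Nu, pu, hNu, hcu⟩ := hupd
  obtain ⟨N, hN⟩ : ∃ N, N = max Ni Nu := ⟨_, rfl⟩
  -- Variable `N` holds the encoding of `some` state, whose second tail is the proposal, and `N + 1`
  -- the reply, whose tail is the tuple of variables. On YES the proposal is moved to the output and
  -- `N` is emptied to leave the loop. Otherwise `0` and `N` both receive the updated state; if it
  -- is `none`, its encoding `nil` ends the loop and is also the output NO.
  obtain ⟨body, hbody⟩ : ∃ body, body = Cmd.seq (.query (N + 1) (.tail (.tail (.var N))))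
    (.ite (.var (N + 1))
      (.seq (.assign 0 (.cons (.tail (.var N)) (.tail (.var (N + 1)))))
        (.seq cu (.assign N (.var 0))))
      (.seq (.assign 0 (.cons .nil (.tail (.tail (.var N))))) (.assign N .nil))) := ⟨_, rfl⟩
  -- There are at most `r + 1` rounds, each with one query. A round costs at most one update and
  -- five further steps; the allowance of six also covers the last test of the loop.
  have hloop : ∀ (n m : ℕ) (C : S.Instance n m) (V : ℕ → S.Assignment n → S.Answer n m),
      CSP.IsRevealing C V → ∀ (r : ℕ) (x : τ × π), Inv C r x → ∀ (σ : Store) (k : ℕ),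
      σ N = enc (some x) → ∃ (σ' : Store) (k' t : ℕ) (out : Option (S.Assignment n)),
        Exec (CSP.oracle V) (.loop (.var N) body) σ k σ' k' t ∧ σ' 0 = CSP.encodeOutput out ∧
        t ≤ (r + 1) * (pu.eval (q.eval n + 1) + 6) ∧ CSP.IsSolution C out := by
    intro n m C V hV r
    induction r using Nat.strong_induction_on with
    | _ r ih =>
    intro x hx σ k hσ
    obtain ⟨a, haW, hax, hstep⟩ := h_step n m C r x hx
    obtain ⟨y, z⟩ := x
    have hquery : Exec (CSP.oracle V) (.query (N + 1) (.tail (.tail (.var N)))) σ k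
        (Function.update σ (N + 1) (CSP.encodeAnswer (V k a))) (k + 1) 1 := by
      refine .query _ _ _ _ _ ⟨a, haW, ?_, rfl⟩
      simp only [Expr.eval, hσ, enc_some, enc_pair, Dat.tail]
      exact hax
    have hσN : (Expr.var N).eval σ ≠ .nil := by simp [Expr.eval, hσ, enc_some]
    have hans := hV k a haW
    rcases hVa : V k a with _ | ⟨j, v⟩
    · rw [hVa] at hquery hans
      have h1 : Run (.ite (.var (N + 1))
          (.seq (.assign 0 (.cons (.tail (.var N)) (.tail (.var (N + 1)))))
            (.seq cu (.assign N (.var 0))))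
          (.seq (.assign 0 (.cons .nil (.tail (.tail (.var N))))) (.assign N .nil)))
          (Function.update σ (N + 1) (CSP.encodeAnswer (none : S.Answer n m))) 3
          fun σ' => σ' 0 = CSP.encodeOutput (some a) ∧ σ' N = .nil := by
        refine Run.ite_false (by simp [Expr.eval, CSP.encodeAnswer])
          (Run.assign_seq (Run.assign ⟨?_, ?_⟩))
        · rw [Function.update_of_ne (by omega)]
          simp [Expr.eval, hσ, enc_some, enc_pair, Dat.tail, CSP.encodeOutput]
          exact hax
        · simp [Expr.eval]
      obtain ⟨σ1, t1, e1, ht1, g0, gN⟩ := h1 (CSP.oracle V) (k + 1)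
      refine ⟨σ1, k + 1, _, some a, .loop_step hσN (hbody ▸ hquery.seq e1)
        (.loop_done (by simp [Expr.eval, gN])), g0, ?_, haW, hans⟩
      rw [add_mul]
      omega
    · rw [hVa] at hquery hans
      obtain ⟨hj, rfl⟩ := hans
      obtain ⟨hnone, hsome⟩ := hstep j hj
      have hin : (enc ((y, z), List.ofFn fun i => ((C j).vars i : ℕ))).height ≤
          q.eval n + 1 := by
        have h1 := h_height n m C r _ hx
        have h2 := h_vars n (C j).vars
        rw [← enc_listNat_ofFn] at h2
        rw [height_pair]
        omega
      obtain ⟨hrun, -⟩ := hcu ((y, z), List.ofFn fun i => ((C j).vars i : ℕ))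
      have h1 : Run (.ite (.var (N + 1))
          (.seq (.assign 0 (.cons (.tail (.var N)) (.tail (.var (N + 1)))))
            (.seq cu (.assign N (.var 0))))
          (.seq (.assign 0 (.cons .nil (.tail (.tail (.var N))))) (.assign N .nil)))
          (Function.update σ (N + 1)
            (CSP.encodeAnswer (some (j, (C j).vars) : S.Answer n m)))
          (pu.eval (q.eval n + 1) + 3)
          fun σ' => σ' 0 = enc (upd ((y, z), List.ofFn fun i => ((C j).vars i : ℕ))) ∧
            σ' N = enc (upd ((y, z), List.ofFn fun i => ((C j).vars i : ℕ))) := by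
        refine (Run.ite_true (by simp [Expr.eval, CSP.encodeAnswer])
          (Run.assign_seq ((hrun _ ?_).seq fun σ2 h2 => Run.assign ?_))).mono ?_ fun _ h => h
        · simp [Expr.eval, hσ, enc_some, enc_pair, Dat.tail, CSP.encodeAnswer, enc_listNat_ofFn]
        · rw [Function.update_of_ne (by omega)]
          simp [Expr.eval, h2.1]
        · have := eval_mono pu hin
          omega
      obtain ⟨σ1, t1, e1, ht1, g0, gN⟩ := h1 (CSP.oracle V) (k + 1)
      rcases hu : upd ((y, z), List.ofFn fun i => ((C j).vars i : ℕ)) with _ | x'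
      · rw [hu] at g0 gN
        refine ⟨σ1, k + 1, _, none, .loop_step hσN (hbody ▸ hquery.seq e1)
          (.loop_done (by simp [Expr.eval, gN, enc_none])), g0, ?_, hnone hu⟩
        rw [add_mul]
        omega
      · rw [hu] at g0 gN
        obtain ⟨r', hr', hx'⟩ := hsome x' hu
        obtain ⟨σ2, k2, t2, out, e2, f0, ht2, hout⟩ := ih r' hr' x' hx' σ1 (k + 1) gN
        refine ⟨σ2, k2, _, out, .loop_step hσN (hbody ▸ hquery.seq e1) e2, f0, ?_, hout⟩
        have : (r' + 1) * (pu.eval (q.eval n + 1) + 6) ≤ r * (pu.eval (q.eval n + 1) + 6) :=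
          Nat.mul_le_mul_right _ hr'
        rw [add_mul]
        omega
  refine ⟨.seq (.assign 0 (.head (.var 0))) (.seq ci (.seq (.assign N (.var 0))
    (.loop (.var N) body))), pi + (B + 1) * (pu.comp (q + 1) + 6) + 3, ?_⟩
  intro n m hn C V hV
  obtain ⟨hnone, hsome⟩ := h_init n m C hn
  obtain ⟨hrun, -⟩ := hci ⟨n, hn⟩
  obtain ⟨σ0, hσ0⟩ : ∃ σ0 : Store, σ0 = Function.update (fun _ => Dat.nil) 0
    (Dat.cons (Dat.ofNat n) (Dat.ofNat m)) := ⟨_, rfl⟩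
  have h1 := hrun (Function.update σ0 0 ((Expr.head (.var 0)).eval σ0))
    (by simp [hσ0, Expr.eval, Dat.head]; rfl)
  obtain ⟨σ1, t1, e1, ht1, g0, -⟩ := h1 (CSP.oracle V) 0
  have hheight : (enc (⟨n, hn⟩ : {n : ℕ // 0 < n})).height = n := height_nat n
  rw [hheight] at ht1
  -- All bounds are polynomial in `n` alone, so this is all that is needed about the instance size.
  have hle : n ≤ S.size n m := by rw [CSP.size]; omega
  have hm := eval_mono (pi + (B + 1) * (pu.comp (q + 1) + 6) + 3) hle
  have e2 : Exec (CSP.oracle V) (.assign N (.var 0)) σ1 0 _ 0 1 := .assign ..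
  rcases hi : init ⟨n, hn⟩ with _ | x
  · refine ⟨_, none, ⟨_, _, hσ0 ▸ (Exec.assign ..).seq (e1.seq (e2.seq (.loop_done ?_))), ?_⟩, ?_,
      hnone hi⟩
    · rw [Function.update_of_ne (by omega), g0, hi]; rfl
    · refine le_trans ?_ hm
      simp
      omega
    · simp [Expr.eval, g0, hi, enc_none]
  · obtain ⟨r, hr, hx⟩ := hsome x hi
    obtain ⟨σ2, k2, t2, out, e3, f0, ht2, hout⟩ := hloop n m C V hV r x hx
      (Function.update σ1 N ((Expr.var 0).eval σ1)) 0 (by simp [Expr.eval, g0, hi])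
    refine ⟨_, out, ⟨_, _, hσ0 ▸ (Exec.assign ..).seq (e1.seq (e2.seq e3)), f0⟩, ?_, hout⟩
    refine le_trans ?_ hm
    have : (r + 1) * (pu.eval (q.eval n + 1) + 6) ≤
        (B.eval n + 1) * (pu.eval (q.eval n + 1) + 6) := Nat.mul_le_mul_right _ (by omega)
    simp
    omega

/-! ### Bit strings -/

/-- The bits of a list, continued by zeros. -/
abbrev bit (l : List Bool) (i : ℕ) : Bool := l.getD i false

theorem bit_set {l : List Bool} {i : ℕ} (hi : i < l.length) (v : Bool) (k : ℕ) :
    bit (l.set i v) k = if k = i then v else bit l k := by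
  by_cases h : k = i
  · subst h; simp [bit, List.getD_eq_getElem?_getD, hi]
  · rw [if_neg h]
    simp [bit, List.getD_eq_getElem?_getD, Ne.symm h]

theorem bit_replicate {n i : ℕ} (hi : i < n) (b : Bool) : bit (List.replicate n b) i = b := by
  simp [bit, List.getD_eq_getElem?_getD, hi]

theorem bit_of_length_le {l : List Bool} {i : ℕ} (hi : l.length ≤ i) : bit l i = false := by
  simp [bit, List.getD_eq_getElem?_getD, List.getElem?_eq_none hi]

/-- The assignment given by a list of bits. -/
def assignOf (n : ℕ) (l : List Bool) (i : Fin n) : Fin 2 := if bit l i then 1 else 0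

/-- The list of the bits of an assignment. -/
def bitsOf {n : ℕ} (z : Fin n → Fin 2) : List Bool := List.ofFn fun i => decide (z i = 1)

theorem length_bitsOf {n : ℕ} (z : Fin n → Fin 2) : (bitsOf z).length = n := by simp [bitsOf]

theorem bit_bitsOf {n : ℕ} (z : Fin n → Fin 2) (i : Fin n) : bit (bitsOf z) i = decide (z i = 1) := by
  simp [bit, bitsOf, List.getD_eq_getElem?_getD]

theorem assignOf_eq_one {n : ℕ} {l : List Bool} {i : Fin n} : assignOf n l i = 1 ↔ bit l i = true := by
  unfold assignOf
  cases bit l i <;> simp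

theorem assignOf_bitsOf {n : ℕ} (z : Fin n → Fin 2) : assignOf n (bitsOf z) = z := by
  funext i
  rw [assignOf, bit_bitsOf]
  generalize z i = b
  revert b
  decide

theorem bitsOf_assignOf {n : ℕ} {l : List Bool} (hl : l.length = n) : bitsOf (assignOf n l) = l := by
  subst hl
  refine List.ext_getElem (length_bitsOf _) fun i h1 h2 => ?_
  simp [bitsOf, assignOf_eq_one, bit, List.getD_eq_getElem?_getD]

theorem enc_bitsOf {n : ℕ} (z : Fin n → Fin 2) : enc (bitsOf z) = Dat.ofTuple z := by
  rw [Dat.ofTuple, bitsOf]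
  change Dat.ofList (List.map Dat.ofBool _) = _
  rw [List.map_ofFn]
  congr 2
  funext i
  simp only [Function.comp]
  generalize z i = b
  revert b
  simp [Fin.forall_fin_two, Dat.ofBool, Dat.ofNat]

theorem enc_eq_ofTuple {n : ℕ} {l : List Bool} (hl : l.length = n) :
    enc l = Dat.ofTuple (assignOf n l) := by
  rw [← enc_bitsOf, bitsOf_assignOf hl]

theorem height_ofTuple_le {k r : ℕ} (v : Fin k → Fin r) : (Dat.ofTuple v).height ≤ r + k := by
  rw [← enc_listNat_ofFn]
  refine (height_list_le (B := r) fun a ha => ?_).trans (by simp)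
  rw [List.mem_ofFn] at ha
  obtain ⟨i, rfl⟩ := ha
  rw [height_nat]
  exact (v i).2.le

theorem PolyFun.bit {α : Type} [Enc α] {f : α → List Bool} {g : α → ℕ} (hf : PolyFun f)
    (hg : PolyFun g) : PolyFun fun a => HiddenCSP.bit (f a) (g a) :=
  (PolyFun.getD false rfl).comp₂ hg hf

/-! ### Binary Boolean constraints -/

/-- The pattern `((i, j), (x, y))` is matched if the variable `i` has the value `x` and the variable
`j` the value `y`. -/
abbrev Pattern : Type := (ℕ × ℕ) × (Bool × Bool)

def Pattern.Matches (c : Pattern) (b : ℕ → Bool) : Prop := b c.1.1 = c.2.1 ∧ b c.1.2 = c.2.2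

/-- If the assignment in `s` matches the pattern `c`, flip one of the two bits in which it agrees
with `a`; if there is none, report a conflict in the first component. -/
def repairStep (a : List Bool) (s : Bool × List Bool) (c : Pattern) : Bool × List Bool :=
  if bit s.2 c.1.1 == c.2.1 && bit s.2 c.1.2 == c.2.2 then
    if bit a c.1.1 == c.2.1 then (s.1, s.2.set c.1.1 !c.2.1)
    else if bit a c.1.2 == c.2.2 then (s.1, s.2.set c.1.2 !c.2.2)
    else (true, s.2)
  else s

def repairPass (a : List Bool) (F : List Pattern) (s : Bool × List Bool) : Bool × List Bool :=
  F.foldl (repairStep a) s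

/-- Flip the bit `i` of `a`, and then further bits as far as this is forced by the forbidden
patterns `F`. -/
def repair (F : List Pattern) (a : List Bool) (i : ℕ) : Bool × List Bool :=
  (repairPass a F)^[a.length] (false, a.set i !bit a i)

theorem length_repairStep (a : List Bool) (s : Bool × List Bool) (c : Pattern) :
    (repairStep a s c).2.length = s.2.length := by
  unfold repairStep
  split_ifs <;> simp

theorem length_repairPass (a : List Bool) (F : List Pattern) (s : Bool × List Bool) :
    (repairPass a F s).2.length = s.2.length := by
  unfold repairPass
  induction F generalizing s with
  | nil => rfl
  | cons c F ih => rw [List.foldl_cons, ih, length_repairStep]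

theorem length_iterate_repairPass (a : List Bool) (F : List Pattern) (s : Bool × List Bool) (k : ℕ) :
    ((repairPass a F)^[k] s).2.length = s.2.length := by
  induction k with
  | zero => rfl
  | succ k ih => rw [Function.iterate_succ_apply', length_repairPass, ih]

theorem height_flagged_le (s : Bool × List Bool) : (enc s).height ≤ s.2.length + 2 := by
  obtain ⟨b, l⟩ := s
  rw [height_pair]
  have h1 := height_bool b
  have h2 := height_listBool_le l
  simp only
  omega

/-! ### Running time of the repair procedure. -/

section
open PolyFun

theorem polyFun_repairStep :
    PolyFun fun x : List Bool × (Bool × List Bool) × Pattern => repairStep x.1 x.2.1 x.2.2 := by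
  have hs : PolyFun fun x : List Bool × (Bool × List Bool) × Pattern => x.2.1.2 :=
    snd.comp (fst.comp snd)
  have hflag : PolyFun fun x : List Bool × (Bool × List Bool) × Pattern => x.2.1.1 :=
    fst.comp (fst.comp snd)
  have hi : PolyFun fun x : List Bool × (Bool × List Bool) × Pattern => x.2.2.1.1 :=
    fst.comp (fst.comp (snd.comp snd))
  have hj : PolyFun fun x : List Bool × (Bool × List Bool) × Pattern => x.2.2.1.2 :=
    snd.comp (fst.comp (snd.comp snd))
  have hx : PolyFun fun x : List Bool × (Bool × List Bool) × Pattern => x.2.2.2.1 :=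
    fst.comp (snd.comp (snd.comp snd))
  have hy : PolyFun fun x : List Bool × (Bool × List Bool) × Pattern => x.2.2.2.2 :=
    snd.comp (snd.comp (snd.comp snd))
  exact (((hs.bit hi).beq hx).and ((hs.bit hj).beq hy)).cond
    (((fst.bit hi).beq hx).cond
      (hflag.pair (set.comp₂ (hi.pair (PolyFun.not.comp hx)) hs))
      (((fst.bit hj).beq hy).cond
        (hflag.pair (set.comp₂ (hj.pair (PolyFun.not.comp hy)) hs))
        ((PolyFun.const true).pair hs)))
    (fst.comp snd)

theorem polyFun_repairPass :
    PolyFun fun x : (List Bool × List Pattern) × (Bool × List Bool) =>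
      repairPass x.1.1 x.1.2 x.2 := by
  refine ((foldl polyFun_repairStep (.X + 2) ?_).comp
    ((fst.comp fst).pair (snd.pair (snd.comp fst)))).of_eq fun x => rfl
  intro a s F F' _
  change (enc (repairPass a F' s)).height ≤ _
  refine (height_flagged_le _).trans ?_
  rw [length_repairPass]
  have h1 := length_le_height s.2
  obtain ⟨b, l⟩ := s
  simp only [height_pair, Polynomial.eval_add, Polynomial.eval_X, Polynomial.eval_ofNat] at *
  omega

theorem polyFun_repair :
    PolyFun fun x : (List Pattern × List Bool) × ℕ => repair x.1.1 x.1.2 x.2 := by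
  have h := foldl (f := fun x : (List Bool × List Pattern) × (Bool × List Bool) × Bool =>
    repairPass x.1.1 x.1.2 x.2.1) (polyFun_repairPass.comp₂ fst (fst.comp snd)) (.X + 2) ?_
  · have ha : PolyFun fun x : (List Pattern × List Bool) × ℕ => x.1.2 := snd.comp fst
    refine (h.comp ((ha.pair (fst.comp fst)).pair (((PolyFun.const false).pair
      (set.comp₂ (snd.pair (PolyFun.not.comp (ha.bit snd))) ha)).pair ha))).of_eq fun x => ?_
    simp only [foldl_const]
    rfl
  · intro a s F F' _
    simp only [foldl_const]
    refine (height_flagged_le _).trans ?_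
    rw [length_iterate_repairPass]
    have h1 := length_le_height s.2
    obtain ⟨b, l⟩ := s
    simp only [height_pair, Polynomial.eval_add, Polynomial.eval_X, Polynomial.eval_ofNat] at *
    omega

end

/-- The state of `repair`: `s.2` differs from `a` at `i`, and all the differences are forced. -/
structure Repairing (F : List Pattern) (a : List Bool) (i : ℕ) (s : Bool × List Bool) : Prop where
  length_eq : s.2.length = a.length
  ne : bit s.2 i ≠ bit a i
  forced : ∀ z : ℕ → Bool, (∀ c ∈ F, ¬ c.Matches z) → z i ≠ bit a i →
    s.1 = false ∧ ∀ k, bit s.2 k ≠ bit a k → z k = bit s.2 k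

/-- The number of differences. -/
def flips (a b : List Bool) : ℕ := ((Finset.range a.length).filter fun k => bit b k ≠ bit a k).card

theorem flips_le (a b : List Bool) : flips a b ≤ a.length :=
  (Finset.card_filter_le _ _).trans (by simp)

theorem flips_lt_flips_set {a b : List Bool} {i : ℕ} (hi : i < a.length) (hb : b.length = a.length)
    (h : bit b i = bit a i) : flips a b < flips a (b.set i !bit b i) := by
  refine Finset.card_lt_card (Finset.ssubset_iff_of_subset (fun k hk => ?_) |>.2 ⟨i, ?_, ?_⟩)
  · rw [Finset.mem_filter] at hk ⊢
    rw [bit_set (by omega), if_neg (fun e => hk.2 (by rw [e, h]))]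
    exact hk
  · rw [Finset.mem_filter, bit_set (by omega), if_pos rfl, h]
    simp [hi]
  · rw [Finset.mem_filter]
    exact fun hk => hk.2 h

/-- A further flip preserves the invariant if its necessity follows from the flips already made;
`hf` may use them, because `forced` provides them for every `z` in question. -/
theorem Repairing.flip {F : List Pattern} {a : List Bool} {i k : ℕ} {s : Bool × List Bool}
    (h : Repairing F a i s) (hk : k < a.length) (hsk : bit s.2 k = bit a k)
    (hf : ∀ z : ℕ → Bool, (∀ c ∈ F, ¬ c.Matches z) → (∀ k, bit s.2 k ≠ bit a k → z k = bit s.2 k) →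
      z k ≠ bit a k) : Repairing F a i (s.1, s.2.set k !bit s.2 k) where
  length_eq := by simp [h.length_eq]
  ne := by
    rw [bit_set (by rw [h.length_eq]; exact hk), if_neg]
    · exact h.ne
    · rintro rfl; exact h.ne hsk
  forced := by
    intro z hz hzi
    obtain ⟨h1, h2⟩ := h.forced z hz hzi
    refine ⟨h1, fun l hl => ?_⟩
    rw [bit_set (by rw [h.length_eq]; exact hk)] at hl ⊢
    split_ifs at hl ⊢ with hlk
    · subst hlk
      have := hf z hz h2
      rw [hsk]
      revert this
      cases z l <;> cases bit a l <;> simp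
    · exact h2 l hl

/-- A pattern matched by `s.2` but not by `a` contains a variable where the two differ, and the
value there is forced. If they agree at the other variable, it has to be flipped as well; if they
differ there too, both values are forced and no suitable `z` exists. This is where it matters that
patterns have only two variables. -/
theorem Repairing.step {F : List Pattern} {a : List Bool} {i : ℕ} {s : Bool × List Bool}
    (h : Repairing F a i s) {c : Pattern} (hc : c ∈ F) (h1 : c.1.1 < a.length)
    (h2 : c.1.2 < a.length) (hca : ¬ c.Matches (bit a)) :
    Repairing F a i (repairStep a s c) ∧
      ((repairStep a s c).1 = false → s.1 = false ∧
        ((repairStep a s c = s ∧ ¬ c.Matches (bit s.2)) ∨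
          flips a s.2 < flips a (repairStep a s c).2)) := by
  obtain ⟨⟨p, q⟩, ⟨x, y⟩⟩ := c
  simp only [Pattern.Matches] at *
  unfold repairStep
  simp only [Bool.and_eq_true, beq_iff_eq]
  split_ifs with hm hp hq
  · obtain ⟨rfl, rfl⟩ := hm
    refine ⟨h.flip h1 hp.symm fun z hz hzs hzp => ?_, fun hs => ⟨hs, .inr ?_⟩⟩
    · have hq : bit s.2 q ≠ bit a q := fun e => hca ⟨hp, e.symm⟩
      exact hz _ hc ⟨by rw [hzp, hp], hzs q hq⟩
    · exact flips_lt_flips_set h1 h.length_eq hp.symm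
  · obtain ⟨rfl, rfl⟩ := hm
    refine ⟨h.flip h2 hq.symm fun z hz hzs hzq => ?_, fun hs => ⟨hs, .inr ?_⟩⟩
    · exact hz _ hc ⟨hzs p (Ne.symm hp), by rw [hzq, hq]⟩
    · exact flips_lt_flips_set h2 h.length_eq hq.symm
  · obtain ⟨rfl, rfl⟩ := hm
    refine ⟨⟨h.length_eq, h.ne, fun z hz hzi => ?_⟩, fun hs => by simp at hs⟩
    obtain ⟨-, hzs⟩ := h.forced z hz hzi
    exact (hz _ hc ⟨hzs p (Ne.symm hp), hzs q (Ne.symm hq)⟩).elim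
  · exact ⟨h, fun hs => ⟨hs, .inl ⟨rfl, hm⟩⟩⟩

/-- A pass without conflict either flips nothing, and then no pattern was matched, or increases the
number of flips, since no bit is ever flipped back. -/
theorem Repairing.foldl {F : List Pattern} {a : List Bool} {i : ℕ}
    (hF : ∀ c ∈ F, c.1.1 < a.length ∧ c.1.2 < a.length ∧ ¬ c.Matches (bit a))
    (F' : List Pattern) (hF' : F' ⊆ F) : ∀ {s : Bool × List Bool}, Repairing F a i s →
    Repairing F a i (F'.foldl (repairStep a) s) ∧
      ((F'.foldl (repairStep a) s).1 = false → s.1 = false ∧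
        ((F'.foldl (repairStep a) s = s ∧ ∀ c ∈ F', ¬ c.Matches (bit s.2)) ∨
          flips a s.2 < flips a (F'.foldl (repairStep a) s).2)) := by
  induction F' with
  | nil => intro s hs; exact ⟨hs, fun h => ⟨h, .inl ⟨rfl, by simp⟩⟩⟩
  | cons c F' ih =>
    intro s hs
    rw [List.foldl_cons]
    have hc : c ∈ F := hF' (by simp)
    obtain ⟨h1, h2, h3⟩ := hF c hc
    obtain ⟨g1, g2⟩ := hs.step hc h1 h2 h3
    obtain ⟨k1, k2⟩ := ih (fun d hd => hF' (by simp [hd])) g1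
    refine ⟨k1, fun hf => ?_⟩
    obtain ⟨l1, l2⟩ := k2 hf
    obtain ⟨m1, m2⟩ := g2 l1
    refine ⟨m1, ?_⟩
    rcases l2 with ⟨e1, e2⟩ | l2
    · rw [e1]
      rcases m2 with ⟨e3, e4⟩ | m2
      · rw [e3] at e2 ⊢
        exact .inl ⟨rfl, List.forall_mem_cons.2 ⟨e4, e2⟩⟩
      · exact .inr m2
    · rcases m2 with ⟨e3, e4⟩ | m2
      · rw [e3] at l2 ⊢
        exact .inr l2
      · exact .inr (m2.trans l2)

/-- The initial flip gives one difference, and every conflict-free pass that has not reached a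
stable assignment adds at least one. As there are at most `a.length` differences, that many passes
suffice. -/
theorem repair_spec {F : List Pattern} {a : List Bool} {i : ℕ} (hi : i < a.length)
    (hF : ∀ c ∈ F, c.1.1 < a.length ∧ c.1.2 < a.length ∧ ¬ c.Matches (bit a)) :
    Repairing F a i (repair F a i) ∧
      ((repair F a i).1 = false → ∀ c ∈ F, ¬ c.Matches (bit (repair F a i).2)) := by
  have key : ∀ k, Repairing F a i ((repairPass a F)^[k] (false, a.set i !bit a i)) ∧
      (((repairPass a F)^[k] (false, a.set i !bit a i)).1 = false →
        (∀ c ∈ F, ¬ c.Matches (bit ((repairPass a F)^[k] (false, a.set i !bit a i)).2)) ∨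
          k < flips a ((repairPass a F)^[k] (false, a.set i !bit a i)).2) := by
    intro k
    induction k with
    | zero =>
      refine ⟨⟨by simp, ?_, fun z hz hzi => ⟨rfl, fun k hk => ?_⟩⟩, fun _ => .inr ?_⟩
      · rw [Function.iterate_zero_apply, bit_set hi, if_pos rfl]
        cases bit a i <;> simp
      · simp only [Function.iterate_zero, id] at hk ⊢
        rw [bit_set hi] at hk ⊢
        split_ifs at hk ⊢ with hki
        · subst hki
          revert hzi
          cases z k <;> cases bit a k <;> simp
        · exact (hk rfl).elim
      · exact (Nat.zero_le _).trans_lt (flips_lt_flips_set hi rfl rfl)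
    | succ k ih =>
      rw [Function.iterate_succ_apply']
      obtain ⟨h1, h2⟩ := ih
      obtain ⟨g1, g2⟩ := h1.foldl hF F (List.Subset.refl F)
      refine ⟨g1, fun hf => ?_⟩
      obtain ⟨k1, k2⟩ := g2 hf
      rcases k2 with ⟨e1, e2⟩ | k2
      · left
        rw [repairPass, e1]
        exact e2
      · rcases h2 k1 with h | h
        · left
          have : repairPass a F ((repairPass a F)^[k] (false, a.set i !bit a i)) =
              (repairPass a F)^[k] (false, a.set i !bit a i) := by
            generalize (repairPass a F)^[k] (false, a.set i !bit a i) = s at h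
            unfold repairPass
            clear * - h
            induction F with
            | nil => rfl
            | cons c F ih =>
              rw [List.foldl_cons]
              have : repairStep a s c = s := by
                unfold repairStep
                rw [if_neg]
                have := h c (by simp)
                simpa [Pattern.Matches] using this
              rw [this, ih fun d hd => h d (by simp [hd])]
          rw [this]
          exact h
        · right
          rw [repairPass]
          omega
  obtain ⟨h1, h2⟩ := key a.length
  refine ⟨h1, fun hf => (h2 hf).resolve_right ?_⟩
  have := flips_le a ((repairPass a F)^[a.length] (false, a.set i !bit a i)).2
  omega

/-- The reaction to the disclosure of a constraint violated by `a`, the second component of the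
state; the first one holds the patterns known to be forbidden. -/
def patternUpdate (x : (List Pattern × List Bool) × List ℕ) : Option (List Pattern × List Bool) :=
  if !(repair x.1.1 x.1.2 (x.2.getD 0 0)).1 then
    some (((x.2.getD 0 0, x.2.getD 1 0), (bit x.1.2 (x.2.getD 0 0), bit x.1.2 (x.2.getD 1 0))) ::
      x.1.1, (repair x.1.1 x.1.2 (x.2.getD 0 0)).2)
  else if !(repair x.1.1 x.1.2 (x.2.getD 1 0)).1 then
    some (((x.2.getD 0 0, x.2.getD 1 0), (bit x.1.2 (x.2.getD 0 0), bit x.1.2 (x.2.getD 1 0))) ::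
      x.1.1, (repair x.1.1 x.1.2 (x.2.getD 1 0)).2)
  else none

open PolyFun in
theorem polyFun_patternUpdate : PolyFun patternUpdate := by
  have hv : ∀ k, PolyFun fun x : (List Pattern × List Bool) × List ℕ => x.2.getD k 0 := fun k =>
    (PolyFun.getD 0 rfl).comp₂ (.const k) snd
  have hr : ∀ k, PolyFun fun x : (List Pattern × List Bool) × List ℕ =>
      repair x.1.1 x.1.2 (x.2.getD k 0) := fun k => polyFun_repair.comp₂ fst (hv k)
  have ha : PolyFun fun x : (List Pattern × List Bool) × List ℕ => x.1.2 := snd.comp fst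
  have hF := cons.comp₂ (((hv 0).pair (hv 1)).pair ((ha.bit (hv 0)).pair (ha.bit (hv 1))))
    (fst.comp (fst (α := List Pattern × List Bool) (β := List ℕ)))
  exact (PolyFun.not.comp (fst.comp (hr 0))).cond
    (PolyFun.some.comp (hF.pair (snd.comp (hr 0))))
    ((PolyFun.not.comp (fst.comp (hr 1))).cond
      (PolyFun.some.comp (hF.pair (snd.comp (hr 1)))) (.const none))

/-- The patterns in `x.1` are forbidden by the instance, and avoided by the proposal `x.2`. -/
structure PatternInv {R : ℕ → Set (Set (Fin 2 → Fin 2))} {n m : ℕ}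
    (C : (binaryBoolean R).Instance n m) (r : ℕ) (x : List Pattern × List Bool) : Prop where
  length_eq : x.2.length = n
  nodup : x.1.Nodup
  lt : ∀ c ∈ x.1, c.1.1 < n ∧ c.1.2 < n
  avoids : ∀ c ∈ x.1, ¬ c.Matches (bit x.2)
  sound : ∀ c ∈ x.1, ∀ z : Fin n → Fin 2, CSP.Satisfies (S := binaryBoolean R) z C →
    ¬ c.Matches (bit (bitsOf z))
  rank : r = n * n * 4 + 1 - x.1.length

theorem PatternInv.length_le {R : ℕ → Set (Set (Fin 2 → Fin 2))} {n m : ℕ}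
    {C : (binaryBoolean R).Instance n m} {r : ℕ} {x : List Pattern × List Bool}
    (h : PatternInv C r x) : x.1.length ≤ n * n * 4 := by
  rw [← List.toFinset_card_of_nodup h.nodup]
  refine (Finset.card_le_card (t := (Finset.range n ×ˢ Finset.range n) ×ˢ Finset.univ)
    fun c hc => ?_).trans (by simp)
  have := h.lt c (by simpa using hc)
  simpa using this

/-- The rank is one more than the number `4 n²` of possible patterns, minus the number of known
ones; the extra one keeps the truncated subtraction strictly decreasing. -/
theorem hiddenPolyTime_binaryBoolean (R : ℕ → Set (Set (Fin 2 → Fin 2))) :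
    (binaryBoolean R).HiddenPolyTime := by
  refine hiddenPolyTime_of_learner (τ := List Pattern) (π := List Bool)
    (fun n => some ([], List.replicate n.1 false)) ?_ patternUpdate polyFun_patternUpdate
    (fun C r x => PatternInv C r x) (.X * .X * 4 + 1) (.X * .X * 4 + .X + 5) ?_ ?_ ?_ ?_
  · have h : PolyFun fun n : {n : ℕ // 0 < n} => n.1 :=
      (PolyFun.id (α := ℕ)).congr_enc (fun n => n.1) (fun _ => rfl) (fun _ => rfl)
    exact PolyFun.some.comp ((PolyFun.const []).pair ((PolyFun.replicate false).comp h))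
  · intro n m C hn
    refine ⟨fun h => by simp at h, fun x hx => ?_⟩
    obtain rfl := Option.some.inj hx
    refine ⟨n * n * 4 + 1, by simp, ?_, ?_, ?_, ?_, ?_, ?_⟩ <;> simp
  · rintro n m C r ⟨F, a⟩ h
    have h1 := h.length_le
    have h2 := height_listBool_le a
    have h3 := h.length_eq
    have h4 : (enc F).height ≤ (n + 3) + F.length := height_list_le fun c hc => by
      have := h.lt c hc
      obtain ⟨⟨i, j⟩, x, y⟩ := c
      have h5 := height_bool x
      have h6 := height_bool y
      simp only [height_pair, height_nat] at *
      omega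
    simp only [height_pair, Polynomial.eval_add, Polynomial.eval_mul, Polynomial.eval_X,
      Polynomial.eval_ofNat] at *
    omega
  · intro n v
    refine (height_ofTuple_le v).trans ?_
    change n + 2 ≤ _
    simp
    omega
  · rintro n m C r ⟨F, a⟩ h
    have hlen : a.length = n := h.length_eq
    refine ⟨assignOf n a, Set.mem_univ _, enc_eq_ofTuple hlen, fun j hj => ?_⟩
    obtain ⟨v, hv⟩ : ∃ v : Fin 2 → Fin n, v = (C j).vars := ⟨_, rfl⟩
    obtain ⟨l, hl⟩ : ∃ l : List ℕ, l = List.ofFn (n := 2) fun i => (v i : ℕ) := ⟨_, rfl⟩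
    have hl' : (List.ofFn fun i => ((C j).vars i : ℕ)) = l := by rw [hl, hv]; rfl
    rw [hl']
    have hl0 : l.getD 0 0 = v 0 := by rw [hl]; rfl
    have hl1 : l.getD 1 0 = v 1 := by rw [hl]; rfl
    -- Whatever the hidden relation is, it sees only these two values: an assignment that agrees
    -- with `a` on both variables violates the constraint too.
    have hsound : ∀ z : Fin n → Fin 2, CSP.Satisfies (S := binaryBoolean R) z C →
        ¬ Pattern.Matches ((v 0, v 1), (bit a (v 0), bit a (v 1))) (bit (bitsOf z)) := by
      intro z hz hm
      have e : ∀ i : Fin 2, z (v i) = assignOf n a (v i) := by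
        have h0 : ∀ i : Fin 2, bit (bitsOf z) (v i) = bit a (v i) :=
          Fin.forall_fin_two.2 hm
        intro i
        have h1 := h0 i
        conv_lhs => rw [← assignOf_bitsOf z]
        rw [assignOf, assignOf, h1]
      refine hj ?_
      have := hz j
      unfold CSP.Constraint.Sat at this ⊢
      have e' : (fun i => assignOf n a ((C j).vars i)) = fun i => z ((C j).vars i) := by
        funext i
        have := e i
        rw [hv] at this
        exact this.symm
      exact e' ▸ this
    have hF : ∀ c ∈ F, c.1.1 < a.length ∧ c.1.2 < a.length ∧ ¬ c.Matches (bit a) := fun c hc =>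
      ⟨hlen ▸ (h.lt c hc).1, hlen ▸ (h.lt c hc).2, h.avoids c hc⟩
    have hr : ∀ i : Fin 2, _ := fun i => repair_spec (i := v i) (hlen ▸ (v i).2) hF
    have hnew : ∀ i : Fin 2, (repair F a (v i)).1 = false → ∃ r' < r, PatternInv C r'
        (((↑(v 0), ↑(v 1)), (bit a (v 0), bit a (v 1))) :: F, (repair F a (v i)).2) := by
      intro i hi
      obtain ⟨h1, h2⟩ := hr i
      refine ⟨n * n * 4 + 1 - (F.length + 1), ?_, ?_, ?_, ?_, ?_, ?_, ?_⟩
      · have := h.rank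
        have := h.length_le
        simp only at *
        omega
      · rw [h1.length_eq, hlen]
      -- The proposal `a` matches the new pattern but none of the old ones, so the new pattern
      -- really is new.
      · exact List.nodup_cons.2 ⟨fun hc => h.avoids _ hc ⟨rfl, rfl⟩, h.nodup⟩
      · exact List.forall_mem_cons.2 ⟨⟨(v 0).2, (v 1).2⟩, h.lt⟩
      -- The repair used only the old patterns. The new one is avoided because matching it means
      -- agreeing with `a` at both variables, one of which has been flipped.
      · refine List.forall_mem_cons.2 ⟨fun hm => h1.ne ?_, h2 hi⟩
        exact (Fin.forall_fin_two (p := fun i =>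
          bit (repair F a (v _)).2 (v i) = bit a (v i))).2 hm i
      · exact List.forall_mem_cons.2 ⟨hsound, h.sound⟩
      · simp
    unfold patternUpdate
    simp only [hl0, hl1]
    cases h0 : (repair F a (v 0)).1
    · refine ⟨fun hn => by simp at hn, fun x' hx' => ?_⟩
      simp only [Bool.not_false, if_true] at hx'
      obtain rfl := Option.some.inj hx'
      exact hnew 0 h0
    · cases h1 : (repair F a (v 1)).1
      · refine ⟨fun hn => by simp at hn, fun x' hx' => ?_⟩
        simp only [Bool.not_false, if_true, Bool.not_true, Bool.false_eq_true, if_false] at hx'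
        obtain rfl := Option.some.inj hx'
        exact hnew 1 h1
      -- After conflicts at both variables, a solution would have to agree with `a` at both, and so
      -- match the pattern just disclosed.
      · refine ⟨fun _ z _ hz => ?_, fun x' hx' => by simp at hx'⟩
        have hzF := fun c hc => h.sound c hc z hz
        refine hsound z hz ⟨by_contra fun hne => ?_, by_contra fun hne => ?_⟩
        · have := ((hr 0).1.forced _ hzF hne).1
          rw [h0] at this
          cases this
        · have := ((hr 1).1.forced _ hzF hne).1
          rw [h1] at this
          cases this

theorem hiddenPolyTime_twoSAT : twoSAT.HiddenPolyTime := hiddenPolyTime_binaryBoolean _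

/-- With two letters, the problem is a binary Boolean one by mere unfolding. -/
theorem hiddenPolyTime_uniqueGames : (uniqueGames 2).HiddenPolyTime :=
  hiddenPolyTime_binaryBoolean fun _ => {R | ∃ π : Equiv.Perm (Fin 2), R = {b | π (b 0) = b 1}}

/-! ### Monotone properties -/

/-- The inputs of a program that decides a property of bit strings of length `len n`. -/
abbrev BitInput (len : ℕ → ℕ) : Type := {x : ℕ × List Bool // 0 < x.1 ∧ x.2.length = len x.1}

/-! ### Greedy completion to an extremal string. -/

namespace BitInput

variable {len : ℕ → ℕ}

def setBit (x : BitInput len) (i : ℕ) (b : Bool) : BitInput len :=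
  ⟨(x.1.1, x.1.2.set i b), x.2.1, by simpa using x.2.2⟩

/-- Set the bit whose number is the second component to `b` if the result satisfies `d`. -/
def greedyStep (d : BitInput len → Bool) (b : Bool) (y : BitInput len × ℕ) : BitInput len × ℕ :=
  (if d (y.1.setBit y.2 b) then y.1.setBit y.2 b else y.1, y.2 + 1)

/-- Set as many bits as possible to `b` such that `d` remains satisfied. -/
def greedy (d : BitInput len → Bool) (b : Bool) (x : BitInput len) : BitInput len :=
  ((greedyStep d b)^[x.1.2.length] (x, 0)).1

/-- The new state of the learning algorithm. -/
def propose (d : BitInput len → Bool) (b : Bool) (x : BitInput len) :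
    Option (BitInput len × List Bool) :=
  if d x then some (x, (greedy d b x).1.2) else none

open PolyFun

theorem polyFun_setBit (b : Bool) : PolyFun fun y : BitInput len × ℕ => y.1.setBit y.2 b := by
  have h : PolyFun fun y : (ℕ × List Bool) × ℕ => (y.1.1, y.1.2.set y.2 b) :=
    (fst.comp fst).pair (set.comp₂ (snd.pair (.const b)) (snd.comp fst))
  exact h.congr_enc (fun y => (y.1.1, y.2)) (fun _ => rfl) (fun _ => rfl)

theorem polyFun_greedyStep {d : BitInput len → Bool} (hd : PolyFun d) (b : Bool) :
    PolyFun (greedyStep d b) :=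
  ((hd.comp (polyFun_setBit b)).cond (polyFun_setBit b) fst).pair (succ.comp snd)

theorem iterate_greedyStep (d : BitInput len → Bool) (b : Bool) (y : BitInput len × ℕ) (k : ℕ) :
    ((greedyStep d b)^[k] y).1.1.1 = y.1.1.1 ∧
      ((greedyStep d b)^[k] y).1.1.2.length = y.1.1.2.length ∧
      ((greedyStep d b)^[k] y).2 = y.2 + k := by
  induction k with
  | zero => simp
  | succ k ih =>
    rw [Function.iterate_succ_apply', greedyStep]
    refine ⟨?_, ?_, ?_⟩
    · split_ifs <;> simp [setBit, ih.1]
    · split_ifs <;> simp [setBit, ih.2.1]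
    · simp [ih.2.2]; omega

theorem height_le (x : BitInput len) : (enc x).height ≤ max x.1.1 (x.1.2.length + 1) + 1 := by
  obtain ⟨⟨n, l⟩, hx⟩ := x
  change (enc (n, l)).height ≤ _
  have := height_listBool_le l
  rw [height_pair, height_nat]
  simp only
  omega

theorem polyFun_val : PolyFun fun x : BitInput len => x.1.2 :=
  (snd (α := ℕ) (β := List Bool)).congr_enc (fun x => x.1) (fun _ => rfl) (fun _ => rfl)

theorem polyFun_greedy {d : BitInput len → Bool} (hd : PolyFun d) (b : Bool) :
    PolyFun (greedy d b) := by
  have h := foldl (f := fun x : Bool × (BitInput len × ℕ) × Bool => greedyStep d b x.2.1)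
    ((polyFun_greedyStep hd b).comp (fst.comp snd)) (2 * .X + 3) ?_
  · refine (fst.comp (h.comp ((PolyFun.const false).pair
      ((PolyFun.id.pair (.const 0)).pair polyFun_val)))).of_eq fun x => ?_
    simp only [foldl_const]
    rfl
  · rintro - ⟨⟨⟨n, l⟩, hx⟩, i⟩ w w' hw
    simp only [foldl_const]
    obtain ⟨h1, h2, h3⟩ := iterate_greedyStep d b (⟨(n, l), hx⟩, i) w'.length
    generalize (greedyStep d b)^[w'.length] (⟨(n, l), hx⟩, i) = y at *
    obtain ⟨y, j⟩ := y
    have h4 := height_le y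
    have h5 := length_le_height l
    have h6 := length_le_height w
    have h7 := hw.length_le
    have h8 : (enc (⟨(n, l), hx⟩ : BitInput len)).height = max n (enc l).height + 1 :=
      (height_pair n l).trans (by rw [height_nat])
    simp only [height_pair, height_nat, Polynomial.eval_add, Polynomial.eval_mul, Polynomial.eval_X,
      Polynomial.eval_ofNat] at *
    omega

theorem polyFun_propose {d : BitInput len → Bool} (hd : PolyFun d) (b : Bool) :
    PolyFun (propose d b) :=
  hd.cond (PolyFun.some.comp (PolyFun.id.pair (polyFun_val.comp (polyFun_greedy hd b))))
    (.const none)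

/-- `y` has the bit `b` wherever `x` has it. -/
def Le (b : Bool) (x y : BitInput len) : Prop :=
  x.1.1 = y.1.1 ∧ ∀ i < x.1.2.length, bit x.1.2 i = b → bit y.1.2 i = b

theorem length_eq {x y : BitInput len} (h : x.1.1 = y.1.1) : x.1.2.length = y.1.2.length := by
  rw [x.2.2, y.2.2, h]

theorem Le.trans {b : Bool} {x y z : BitInput len} (h : Le b x y) (h' : Le b y z) : Le b x z :=
  ⟨h.1.trans h'.1, fun i hi hx => h'.2 i (length_eq h.1 ▸ hi) (h.2 i hi hx)⟩

theorem bit_setBit {x : BitInput len} {i : ℕ} (hi : i < x.1.2.length) (b : Bool) (k : ℕ) :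
    bit (x.setBit i b).1.2 k = if k = i then b else bit x.1.2 k := bit_set hi b k

theorem le_setBit {b : Bool} (x : BitInput len) {i : ℕ} (hi : i < x.1.2.length) :
    Le b x (x.setBit i b) :=
  ⟨rfl, fun k _ hk => by rw [bit_setBit hi]; split_ifs <;> trivial⟩

theorem Le.setBit {b : Bool} {x y : BitInput len} (h : Le b x y) {i : ℕ} (hi : i < x.1.2.length) :
    Le b (x.setBit i b) (y.setBit i b) :=
  ⟨h.1, fun k hk hx => by
    rw [bit_setBit (length_eq h.1 ▸ hi)]
    rw [bit_setBit hi] at hx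
    split_ifs at hx ⊢
    · rfl
    · exact h.2 k (by simpa [BitInput.setBit] using hk) hx⟩

theorem setBit_le {b : Bool} {x y : BitInput len} (h : Le b x y) {i : ℕ} (hi : i < x.1.2.length)
    (hy : bit y.1.2 i = b) : Le b (x.setBit i b) y :=
  ⟨h.1, fun k hk hx => by
    rw [bit_setBit hi] at hx
    split_ifs at hx with hki
    · rw [hki, hy]
    · exact h.2 k (by simpa [BitInput.setBit] using hk) hx⟩

/-- One pass suffices, because a refused position stays refused: later strings carry the letter `b`
at more positions, and by `hd` the property descends to strings with fewer. For the same reason no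
`y` above the result with property `d` can have a further `b`: the result with that single bit set
would have been accepted. -/
theorem greedy_spec {d : BitInput len → Bool} {b : Bool}
    (hd : ∀ x y, Le b x y → d y = true → d x = true) {x : BitInput len} (hx : d x = true) :
    d (greedy d b x) = true ∧ Le b x (greedy d b x) ∧
      ∀ y, Le b (greedy d b x) y → d y = true → Le b y (greedy d b x) := by
  have key : ∀ k ≤ x.1.2.length, d ((greedyStep d b)^[k] (x, 0)).1 = true ∧
      Le b x ((greedyStep d b)^[k] (x, 0)).1 ∧
      ∀ i < k, bit ((greedyStep d b)^[k] (x, 0)).1.1.2 i = b ∨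
        d (((greedyStep d b)^[k] (x, 0)).1.setBit i b) = false := by
    intro k hk
    induction k with
    | zero => exact ⟨hx, ⟨rfl, fun _ _ h => h⟩, by simp⟩
    | succ k ih =>
      obtain ⟨h1, h2, h3⟩ := ih (by omega)
      obtain ⟨-, g2, g3⟩ := iterate_greedyStep d b (x, 0) k
      rw [Function.iterate_succ_apply']
      generalize (greedyStep d b)^[k] (x, 0) = y at *
      obtain ⟨z, j⟩ := y
      simp only at *
      obtain rfl : k = j := by omega
      unfold greedyStep
      simp only
      split_ifs with hz
      · have hle := le_setBit (b := b) z (i := k) (by omega)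
        refine ⟨hz, h2.trans hle, fun i hi => ?_⟩
        by_cases hik : i = k
        · left; rw [bit_setBit (by omega), if_pos hik]
        · rcases h3 i (by omega) with h | h
          · left; rw [bit_setBit (by omega), if_neg hik, h]
          · right
            rw [← Bool.not_eq_true] at h ⊢
            exact fun h' => h (hd _ _ (hle.setBit (by omega)) h')
      · refine ⟨h1, h2, fun i hi => ?_⟩
        by_cases hik : i = k
        · right; rw [hik]; simpa using hz
        · exact h3 i (by omega)
  obtain ⟨h1, h2, h3⟩ := key _ le_rfl
  refine ⟨h1, h2, fun y hy hdy => ⟨hy.1.symm, fun i hi hyi => ?_⟩⟩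
  have hlen := length_eq h2.1
  rw [← length_eq hy.1] at hi
  change i < ((greedyStep d b)^[x.1.2.length] (x, 0)).1.1.2.length at hi
  refine (h3 i (by omega)).resolve_right fun h => ?_
  rw [← Bool.not_eq_true] at h
  exact h (hd _ y (setBit_le hy hi hyi) hdy)

end BitInput

/-- The letter of a bit. -/
def bitVal (b : Bool) : Fin 2 := if b then 1 else 0

theorem assignOf_eq_bitVal {n : ℕ} {l : List Bool} {i : Fin n} {b : Bool} :
    assignOf n l i = bitVal b ↔ bit l i = b := by
  unfold assignOf bitVal
  cases bit l i <;> cases b <;> simp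

theorem polyFun_of_decidablePolyTime {len : ℕ → ℕ} {f : ∀ n, (Fin (len n) → Fin 2) → Prop}
    (hf : DecidablePolyTime len f) (d : BitInput len → Bool)
    (hd : ∀ x, d x = true ↔ f x.1.1 (assignOf (len x.1.1) x.1.2)) : PolyFun d := by
  obtain ⟨c, p, hc⟩ := hf
  refine PolyFun.of_computes c p fun ⟨⟨n, l⟩, hn, hl⟩ => ?_
  obtain ⟨t, r, h1, h2, h3⟩ := hc n hn (assignOf (len n) l)
  refine ⟨t, r, ?_, h2.trans (eval_mono p ?_), by rw [hd]; exact h3⟩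
  · rw [← enc_eq_ofTuple hl] at h1
    exact h1
  · have h : (enc (n, l)).height = _ := height_pair _ _
    change n ≤ (enc (n, l)).height
    rw [h, height_nat]
    omega

/-- The problem to find, among the extremal strings in `W`, one that has the letter `v` at the
positions named by the constraints. -/
def unaryCSP (len : ℕ → ℕ) (W : ∀ n, Set (Fin (len n) → Fin 2)) (v : Fin 2) : CSP where
  w _ := 2
  len := len
  q _ := 1
  W := W
  rels _ := {{b | b 0 = v}}

-- The parameter `b` covers both directions of monotonicity: `f` descends to strings with fewer
-- letters `bitVal b`, and `W` consists of the strings with property `f` in which the set of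
-- positions of that letter is maximal. The state is the string with the letter at exactly the
-- disclosed positions, and the rank counts the remaining positions.
open BitInput in
theorem hiddenPolyTime_unaryCSP {len : ℕ → ℕ} (hlen : PolyFun len)
    {f : ∀ n, (Fin (len n) → Fin 2) → Prop} (hf : DecidablePolyTime len f) (b : Bool)
    (hmono : ∀ n a a', f n a → (∀ i, a' i = bitVal b → a i = bitVal b) → f n a')
    (W : ∀ n, Set (Fin (len n) → Fin 2))
    (hW : ∀ n a, a ∈ W n ↔ f n a ∧ ∀ a', f n a' → (∀ i, a i = bitVal b → a' i = bitVal b) →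
      ∀ i, a' i = bitVal b → a i = bitVal b) :
    (unaryCSP len W (bitVal b)).HiddenPolyTime := by
  classical
  obtain ⟨d, hd⟩ : ∃ d : BitInput len → Bool,
      ∀ x, d x = true ↔ f x.1.1 (assignOf (len x.1.1) x.1.2) :=
    ⟨fun x => decide (f x.1.1 (assignOf (len x.1.1) x.1.2)), fun x => by simp⟩
  have hdp := polyFun_of_decidablePolyTime hf d hd
  have hdm : ∀ x y, Le b x y → d y = true → d x = true := by
    rintro ⟨⟨n, l⟩, hn, hl⟩ ⟨⟨n', l'⟩, hn', hl'⟩ ⟨h1, h2⟩ h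
    simp only at h1 h2 hl hl'
    subst h1
    rw [hd] at h ⊢
    refine hmono n _ _ h fun i hi => ?_
    rw [assignOf_eq_bitVal] at hi ⊢
    exact h2 i (i.2.trans_eq hl.symm) hi
  have hpn : PolyFun fun n : {n : ℕ // 0 < n} => n.1 :=
    (PolyFun.id (α := ℕ)).congr_enc (fun n => n.1) (fun _ => rfl) (fun _ => rfl)
  -- The height of a unary number is its value, so the height bound in `PolyFun` bounds `len`
  -- itself.
  obtain ⟨B, hB⟩ : ∃ B : Polynomial ℕ, ∀ n, len n ≤ B.eval n := by
    obtain ⟨_, _, p, -, hp⟩ := id hlen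
    refine ⟨p, fun n => ?_⟩
    have := (hp n).2
    rwa [height_nat, height_nat] at this
  obtain ⟨start, hstart⟩ : ∃ start : {n : ℕ // 0 < n} → BitInput len,
      ∀ n, (start n).1 = (n.1, List.replicate (len n.1) !b) :=
    ⟨fun n => ⟨(n.1, List.replicate (len n.1) !b), n.2, by simp⟩, fun _ => rfl⟩
  have hstartp : PolyFun start := by
    refine (hpn.pair ((PolyFun.replicate !b).comp (hlen.comp hpn))).congr_enc (fun n => n)
      (fun _ => rfl) fun n => ?_
    change enc (start n).1 = _
    rw [hstart]
  -- a state that admits a solution satisfies the property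
  have hnone : ∀ (n m : ℕ) (C : (unaryCSP len W (bitVal b)).Instance n m) (x : BitInput len),
      x.1.1 = n → (∀ z : Fin (len n) → Fin 2, CSP.Satisfies (S := unaryCSP len W (bitVal b)) z C →
        ∀ i : Fin (len n), bit x.1.2 i = b → z i = bitVal b) →
      propose d b x = none → ∀ a ∈ (unaryCSP len W (bitVal b)).W n, ¬ CSP.Satisfies a C := by
    rintro n m C ⟨⟨n', l⟩, hn, hl⟩ hx hs hp z hz hzC
    simp only at hx
    subst hx
    rw [propose] at hp
    split_ifs at hp with hdx
    -- A solution `z` has the letter wherever the state has it, so the property descends from `z` to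
    -- the state.
    refine hdx ((hd _).2 (hmono _ _ _ ((hW _ z).1 hz).1 fun i hi => ?_))
    rw [assignOf_eq_bitVal] at hi
    exact hs z hzC i hi
  refine hiddenPolyTime_of_learner (τ := BitInput len) (π := List Bool)
    (fun n => propose d b (start n)) ((polyFun_propose hdp b).comp hstartp)
    (fun y => propose d b (y.1.1.setBit (y.2.getD 0 0) b))
    ((polyFun_propose hdp b).comp ((polyFun_setBit b).comp₂ (PolyFun.fst.comp PolyFun.fst)
      ((PolyFun.getD 0 rfl).comp₂ (.const 0) PolyFun.snd)))
    (fun {n m} C r y => y.1.1.1 = n ∧ d y.1 = true ∧ y.2 = (greedy d b y.1).1.2 ∧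
      (∀ z : Fin (len n) → Fin 2, CSP.Satisfies (S := unaryCSP len W (bitVal b)) z C →
        ∀ i : Fin (len n), bit y.1.1.2 i = b → z i = bitVal b) ∧
      r = ((Finset.range (len n)).filter fun i => bit y.1.1.2 i ≠ b).card)
    B (.X + B + 3) ?_ ?_ ?_ ?_
  · intro n m C hn
    have h0 : ∀ z : Fin (len n) → Fin 2, CSP.Satisfies (S := unaryCSP len W (bitVal b)) z C →
        ∀ i : Fin (len n), bit (start ⟨n, hn⟩).1.2 i = b → z i = bitVal b := by
      intro z _ i hi
      rw [hstart, bit_replicate i.2] at hi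
      cases b <;> simp at hi
    refine ⟨hnone n m C _ (by rw [hstart]) h0, fun x hx => ?_⟩
    rw [propose] at hx
    split_ifs at hx with hdx
    obtain rfl := Option.some.inj hx
    refine ⟨_, ?_, by simp only [hstart], hdx, rfl, h0, rfl⟩
    exact (Finset.card_filter_le _ _).trans (by simpa using hB n)
  · rintro n m C r ⟨x, l⟩ ⟨h1, h2, h3, -⟩
    have h4 := (greedy_spec hdm h2).2.1.1
    have h5 := height_le x
    have h6 := height_listBool_le l
    have h7 := x.2.2
    have h8 := (greedy d b x).2.2
    have h9 := hB n
    simp only at h1 h3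
    rw [← h3, ← h4, h1] at h8
    rw [h1] at h5 h7
    simp only [height_pair, Polynomial.eval_add, Polynomial.eval_X, Polynomial.eval_ofNat] at *
    omega
  · intro n v
    refine (height_ofTuple_le v).trans ?_
    have := hB n
    change len n + 1 ≤ _
    simp
    omega
  · rintro n m C r ⟨x, l⟩ ⟨h1, h2, h3, h4, h5⟩
    simp only at h1 h2 h3 h4 h5
    obtain ⟨g1, g2, g3⟩ := greedy_spec hdm h2
    have hn : 0 < n := h1 ▸ x.2.1
    have hxlen : x.1.2.length = len n := by rw [x.2.2, h1]
    have hllen : l.length = len n := by rw [h3, ← length_eq g2.1, hxlen]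
    have hgn : (greedy d b x).1.1 = n := by rw [← g2.1, h1]
    have hgl : (greedy d b x).1 = (n, l) := Prod.ext hgn h3.symm
    refine ⟨assignOf (len n) l, (hW n _).2 ⟨?_, fun a' ha' hle i hi => ?_⟩, enc_eq_ofTuple hllen,
      fun j hj => ?_⟩
    · rw [hd, hgl] at g1
      exact g1
    · obtain ⟨y, hy⟩ : ∃ y : BitInput len, y.1 = (n, bitsOf a') :=
        ⟨⟨(n, bitsOf a'), hn, length_bitsOf _⟩, rfl⟩
      have hyb : ∀ i : Fin (len n), bit (bitsOf a') i = b ↔ a' i = bitVal b := fun i => by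
        rw [← assignOf_eq_bitVal, assignOf_bitsOf]
      have := g3 y ⟨by rw [hgl, hy], fun i hi hbi => ?_⟩ ?_
      · have := this.2 i (by rw [hy]; simp [length_bitsOf]) (by rw [hy]; exact (hyb i).2 hi)
        rw [assignOf_eq_bitVal]
        rwa [hgl] at this
      · rw [hgl] at hi hbi
        simp only at hi hbi
        rw [hllen] at hi
        rw [hy]
        exact (hyb ⟨i, hi⟩).2 (hle ⟨i, hi⟩ (assignOf_eq_bitVal.2 hbi))
      · rw [hd, hy]
        simp only
        rwa [assignOf_bitsOf]
    · obtain ⟨e, he⟩ : ∃ e : Fin (len n), e = (C j).vars (0 : Fin 1) := ⟨_, rfl⟩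
      have hrel : (C j).rel = {c : Fin 1 → Fin 2 | c 0 = bitVal b} := (C j).rel_mem
      have hsat : ∀ z : Fin (len n) → Fin 2,
          (C j).Sat (S := unaryCSP len W (bitVal b)) z ↔ z e = bitVal b := by
        intro z
        unfold CSP.Constraint.Sat
        rw [hrel, he]
        rfl
      have hl : (List.ofFn fun i => ((C j).vars i : ℕ)).getD 0 0 = e := by rw [he]; rfl
      rw [hl]
      have hle : bit l e ≠ b := fun h => hj ((hsat _).2 (assignOf_eq_bitVal.2 h))
      -- The greedy completion keeps all recorded letters, so a position that lacks the letter in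
      -- the proposal is not yet recorded.
      have hxe : bit x.1.2 e ≠ b := fun h => hle (by
        have := g2.2 e (by rw [hxlen]; exact e.2) h
        rwa [hgl] at this)
      have hei : (e : ℕ) < x.1.2.length := by rw [hxlen]; exact e.2
      have h0 : ∀ z : Fin (len n) → Fin 2, CSP.Satisfies (S := unaryCSP len W (bitVal b)) z C →
          ∀ i : Fin (len n), bit (x.setBit e b).1.2 i = b → z i = bitVal b := by
        intro z hz i hi
        rw [bit_setBit hei] at hi
        split_ifs at hi with hie
        · rw [Fin.ext hie]
          exact (hsat z).1 (hz j)
        · exact h4 z hz i hi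
      refine ⟨hnone n m C _ h1 h0, fun x' hx' => ?_⟩
      simp only [propose] at hx'
      split_ifs at hx' with hdx
      obtain rfl := Option.some.inj hx'
      refine ⟨_, ?_, h1, hdx, rfl, h0, rfl⟩
      rw [h5]
      refine Finset.card_lt_card (Finset.ssubset_iff_of_subset (fun k hk => ?_) |>.2 ⟨e, ?_, ?_⟩)
      · rw [Finset.mem_filter, bit_setBit hei] at hk
        rw [Finset.mem_filter]
        refine ⟨hk.1, ?_⟩
        have := hk.2
        split_ifs at this with hke
        · exact (this rfl).elim
        · exact this
      · rw [Finset.mem_filter]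
        exact ⟨by simp, hxe⟩
      · rw [Finset.mem_filter, bit_setBit hei, if_pos rfl]
        simp

theorem bitFun_le_iff_one {ι : Type} {a b : ι → Fin 2} : a ≤ b ↔ ∀ i, a i = 1 → b i = 1 := by
  have key : ∀ x y : Fin 2, x ≤ y ↔ (x = 1 → y = 1) := by decide
  exact forall_congr' fun i => key _ _

theorem bitFun_le_iff_zero {ι : Type} {a b : ι → Fin 2} : a ≤ b ↔ ∀ i, b i = 0 → a i = 0 := by
  have key : ∀ x y : Fin 2, x ≤ y ↔ (y = 0 → x = 0) := by decide
  exact forall_congr' fun i => key _ _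

/-- Constraints demand the letter `0`, and minimality of a string is maximality of its set of zeros.
-/
theorem hiddenPolyTime_increasingCSP {len : ℕ → ℕ} (hlen : PolyFun len)
    {f : ∀ n, (Fin (len n) → Fin 2) → Prop} (hf : DecidablePolyTime len f)
    (hmono : ∀ n, Monotone (f n)) : (increasingCSP len f).HiddenPolyTime := by
  refine hiddenPolyTime_unaryCSP hlen hf false (fun n a a' h h' => ?_) (fun n => {a | Minimal (f n) a})
    fun n a => ?_
  · exact hmono n (bitFun_le_iff_zero.2 h') h
  · refine and_congr_right fun _ => forall_congr' fun a' => imp_congr_right fun _ => ?_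
    rw [bitFun_le_iff_zero, bitFun_le_iff_zero]
    rfl

theorem hiddenPolyTime_decreasingCSP {len : ℕ → ℕ} (hlen : PolyFun len)
    {f : ∀ n, (Fin (len n) → Fin 2) → Prop} (hf : DecidablePolyTime len f)
    (hanti : ∀ n, Antitone (f n)) : (decreasingCSP len f).HiddenPolyTime := by
  refine hiddenPolyTime_unaryCSP hlen hf true (fun n a a' h h' => ?_) (fun n => {a | Maximal (f n) a})
    fun n a => ?_
  · exact hanti n (bitFun_le_iff_one.2 h') h
  · refine and_congr_right fun _ => forall_congr' fun a' => imp_congr_right fun _ => ?_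
    rw [bitFun_le_iff_one, bitFun_le_iff_one]
    rfl

theorem graphOf_mono {n : ℕ} : Monotone (graphOf (n := n)) := fun _ _ h _ _ ⟨hne, e, he, hae⟩ =>
  ⟨hne, e, he, bitFun_le_iff_one.1 h e hae⟩

theorem digraphOf_mono {n : ℕ} : Monotone (digraphOf (n := n)) := fun _ _ h _ _ huv =>
  bitFun_le_iff_one.1 h _ huv

/-! ### Spanning trees -/

theorem height_pair_le {α β : Type} [Enc α] [Enc β] {a : α} {b : β} {H : ℕ}
    (h : (enc (a, b)).height ≤ H) : (enc a).height ≤ H ∧ (enc b).height ≤ H := by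
  rw [height_pair] at h
  omega

namespace PolyFun

variable {α γ : Type} [Enc α] [Enc γ]

theorem range : PolyFun fun n : ℕ => List.range n := by
  have key : ∀ i a L, (fun x : ℕ × List ℕ => (x.1 + 1, x.1 :: x.2))^[i] (a, L) =
      (a + i, (List.range' a i).reverse ++ L) := by
    intro i a L
    induction i with
    | zero => simp
    | succ i ih => rw [Function.iterate_succ_apply', ih, List.range'_concat]; simp; omega
  refine (reverse.comp (snd.comp ((iterate (f := fun x : ℕ × List ℕ => (x.1 + 1, x.1 :: x.2))
    ((succ.comp fst).pair (cons.comp PolyFun.id)) (5 * .X + 1) ?_).comp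
    (PolyFun.id.pair ((PolyFun.const 0).pair (.const [])))))).of_eq fun n => ?_
  · rintro n ⟨a, L⟩ i hi
    rw [key]
    have h1 := length_le_height L
    have h2 : (enc ((List.range' a i).reverse ++ L)).height ≤
        a + i + (enc L).height + (i + L.length) := by
      refine (height_list_le (B := a + i + (enc L).height) fun x hx => ?_).trans (by simp)
      rw [List.mem_append, List.mem_reverse, List.mem_range'_1] at hx
      rcases hx with hx | hx
      · rw [height_nat]; omega
      · have := height_mem hx; omega
    simp only [height_pair, height_nat, Polynomial.eval_add, Polynomial.eval_mul,
      Polynomial.eval_X, Polynomial.eval_ofNat, Polynomial.eval_one] at *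
    omega
  · rw [key]; simp [List.range_eq_range']

theorem all {g : γ × α → Bool} (hg : PolyFun g) :
    PolyFun fun x : γ × List α => x.2.all fun a => g (x.1, a) := by
  have key : ∀ (c : γ) (l : List α) (b : Bool),
      l.foldl (fun b a => b && g (c, a)) b = (b && l.all fun a => g (c, a)) := by
    intro c l
    induction l with
    | nil => simp
    | cons a l ih => intro b; rw [List.foldl_cons, ih, List.all_cons, Bool.and_assoc]
  refine ((foldl (f := fun x : γ × Bool × α => x.2.1 && g (x.1, x.2.2))
    ((fst.comp snd).and (hg.comp₂ fst (snd.comp snd))) 1 ?_).comp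
    (fst.pair ((PolyFun.const true).pair snd))).of_eq fun x => ?_
  · intro x b l l' _
    simpa using height_bool _
  · simp only [key, Bool.true_and]

end PolyFun

/-- Merge the components of `u` and `v` by the edge number `e`, if they are different and `b` is
set; the first list holds the labels of the components, the second one the edges of the forest. -/
def addEdge (b : Bool) (u v e : ℕ) (x : List ℕ × List Bool) : List ℕ × List Bool :=
  if b && !decide (x.1.getD u 0 = x.1.getD v 0) then
    (x.1.map fun c => if c = x.1.getD v 0 then x.1.getD u 0 else c, x.2.set e true)
  else x

/-- Process the pair `u < v` with number `e`, and pass to the next one. -/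
def kruskalStep (s : (ℕ × ℕ) × (ℕ × (List ℕ × List Bool))) (b : Bool) :
    (ℕ × ℕ) × (ℕ × (List ℕ × List Bool)) :=
  (if s.1.1 + 1 = s.1.2 then (0, s.1.2 + 1) else (s.1.1 + 1, s.1.2),
    (s.2.1 + 1, addEdge b s.1.1 s.1.2 s.2.1 s.2.2))

/-- Extend a forest greedily by pairs of vertices that are marked in a list of bits. -/
def kruskal (l : List Bool) (x : List ℕ × List Bool) : List ℕ × List Bool :=
  (l.foldl kruskalStep ((0, 1), (0, x))).2.2

/-- The result of Kruskal's algorithm that prefers the edges in the first list to those in the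
second list. -/
def spanningForest (n : ℕ) (y : List Bool × List Bool) : List ℕ × List Bool :=
  kruskal y.2 (kruskal y.1 (List.range n, List.replicate (n.choose 2) false))

def forestCheck (n : ℕ) (y : List Bool × List Bool) (x : List ℕ × List Bool) : Bool :=
  ((List.range n).all fun i => decide (x.1.getD i 0 = x.1.getD 0 0)) &&
    (List.range (n.choose 2)).all fun e =>
      (if bit y.1 e then bit x.2 e else true) && if bit x.2 e then bit y.2 e else true

/-- A spanning tree containing the edges in the first list and contained in the second list. -/
def proposeTree (x : ℕ × (List Bool × List Bool)) :
    Option ((ℕ × (List Bool × List Bool)) × List Bool) :=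
  if forestCheck x.1 x.2 (spanningForest x.1 x.2) then some (x, (spanningForest x.1 x.2).2)
  else none

/-- The reaction to the disclosure of a pair that is a wrongly chosen edge or non-edge. -/
def treeUpdate (x : ((ℕ × (List Bool × List Bool)) × List Bool) × List ℕ) :
    Option ((ℕ × (List Bool × List Bool)) × List Bool) :=
  if bit x.1.2 (x.2.getD 0 0) then
    proposeTree (x.1.1.1, (x.1.1.2.1, x.1.1.2.2.set (x.2.getD 0 0) false))
  else proposeTree (x.1.1.1, (x.1.1.2.1.set (x.2.getD 0 0) true, x.1.1.2.2))

/-! #### Running time -/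

section
open PolyFun

theorem polyFun_relabel : PolyFun fun x : (ℕ × ℕ) × List ℕ =>
    x.2.map fun c => if c = x.1.1 then x.1.2 else c := by
  refine map (g := fun x : (ℕ × ℕ) × ℕ => if x.2 = x.1.1 then x.1.2 else x.2) ?_
  exact ((decide_eq.comp₂ snd (fst.comp fst)).cond (snd.comp fst) snd).of_eq
    fun x => by simp only [decide_eq_true_eq]

theorem polyFun_addEdge : PolyFun fun x : (Bool × (ℕ × ℕ × ℕ)) × (List ℕ × List Bool) =>
    addEdge x.1.1 x.1.2.1 x.1.2.2.1 x.1.2.2.2 x.2 := by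
  have hl : PolyFun fun x : (Bool × (ℕ × ℕ × ℕ)) × (List ℕ × List Bool) => x.2.1 := fst.comp snd
  have hu : PolyFun fun x : (Bool × (ℕ × ℕ × ℕ)) × (List ℕ × List Bool) => x.2.1.getD x.1.2.1 0 :=
    (PolyFun.getD 0 rfl).comp₂ (fst.comp (snd.comp fst)) hl
  have hv : PolyFun fun x : (Bool × (ℕ × ℕ × ℕ)) × (List ℕ × List Bool) =>
      x.2.1.getD x.1.2.2.1 0 :=
    (PolyFun.getD 0 rfl).comp₂ (fst.comp (snd.comp (snd.comp fst))) hl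
  have he : PolyFun fun x : (Bool × (ℕ × ℕ × ℕ)) × (List ℕ × List Bool) => x.1.2.2.2 :=
    snd.comp (snd.comp (snd.comp fst))
  exact ((fst.comp fst).and (PolyFun.not.comp (decide_eq.comp₂ hu hv))).cond
    ((polyFun_relabel.comp₂ (hv.pair hu) hl).pair
      (set.comp₂ (he.pair (.const true)) (snd.comp snd))) snd

theorem polyFun_kruskalStep :
    PolyFun fun x : Bool × ((ℕ × ℕ) × (ℕ × (List ℕ × List Bool))) × Bool =>
      kruskalStep x.2.1 x.2.2 := by
  have hs : PolyFun fun x : Bool × ((ℕ × ℕ) × (ℕ × (List ℕ × List Bool))) × Bool => x.2.1 :=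
    fst.comp snd
  have hu := fst.comp (fst.comp hs)
  have hv := snd.comp (fst.comp hs)
  have he := fst.comp (snd.comp hs)
  have hnext : PolyFun fun x : Bool × ((ℕ × ℕ) × (ℕ × (List ℕ × List Bool))) × Bool =>
      if x.2.1.1.1 + 1 = x.2.1.1.2 then (0, x.2.1.1.2 + 1) else (x.2.1.1.1 + 1, x.2.1.1.2) :=
    ((decide_eq.comp₂ (succ.comp hu) hv).cond ((PolyFun.const 0).pair (succ.comp hv))
      ((succ.comp hu).pair hv)).of_eq fun x => by simp only [decide_eq_true_eq]
  exact hnext.pair ((succ.comp he).pair (polyFun_addEdge.comp₂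
    ((snd.comp snd).pair (hu.pair (hv.pair he))) (snd.comp (snd.comp hs))))

/-- Merging only copies an existing label, or the default 0, so labels stay below any initial bound.
This controls the accumulators of the fold. -/
theorem addEdge_bounds (b : Bool) (u v e : ℕ) (x : List ℕ × List Bool) :
    (addEdge b u v e x).1.length = x.1.length ∧ (addEdge b u v e x).2.length = x.2.length ∧
      ∀ M, (∀ c ∈ x.1, c ≤ M) → ∀ c ∈ (addEdge b u v e x).1, c ≤ M := by
  unfold addEdge
  split_ifs
  · refine ⟨by simp, by simp, fun M hM c hc => ?_⟩
    rw [List.mem_map] at hc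
    obtain ⟨d, hd, rfl⟩ := hc
    split_ifs
    · rw [List.getD_eq_getElem?_getD]
      rcases hu : x.1[u]? with _ | c
      · simp
      · exact hM c (List.mem_of_getElem? hu)
    · exact hM d hd
  · exact ⟨rfl, rfl, fun _ h => h⟩

theorem kruskalStep_bounds (l : List Bool) (s : (ℕ × ℕ) × (ℕ × (List ℕ × List Bool))) :
    (l.foldl kruskalStep s).1.1 ≤ s.1.1 + l.length ∧
      (l.foldl kruskalStep s).1.2 ≤ s.1.2 + l.length ∧
      (l.foldl kruskalStep s).2.1 = s.2.1 + l.length ∧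
      (l.foldl kruskalStep s).2.2.1.length = s.2.2.1.length ∧
      (l.foldl kruskalStep s).2.2.2.length = s.2.2.2.length ∧
      ∀ M, (∀ c ∈ s.2.2.1, c ≤ M) → ∀ c ∈ (l.foldl kruskalStep s).2.2.1, c ≤ M := by
  induction l generalizing s with
  | nil => exact ⟨le_rfl, le_rfl, rfl, rfl, rfl, fun _ h => h⟩
  | cons b l ih =>
    obtain ⟨h1, h2, h3, h4, h5, h6⟩ := ih (kruskalStep s b)
    obtain ⟨g1, g2, g3⟩ := addEdge_bounds b s.1.1 s.1.2 s.2.1 s.2.2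
    have k1 : (kruskalStep s b).1.1 ≤ s.1.1 + 1 := by
      unfold kruskalStep; simp only; split_ifs <;> simp
    have k2 : (kruskalStep s b).1.2 ≤ s.1.2 + 1 := by
      unfold kruskalStep; simp only; split_ifs <;> simp
    have k3 : (kruskalStep s b).2.1 = s.2.1 + 1 := rfl
    rw [List.foldl_cons, List.length_cons]
    exact ⟨by omega, by omega, by omega, h4.trans g1, h5.trans g2, fun M hM => h6 M (g3 M hM)⟩

theorem polyFun_kruskal :
    PolyFun fun x : List Bool × (List ℕ × List Bool) => kruskal x.1 x.2 := by
  refine (snd.comp (snd.comp ((foldl polyFun_kruskalStep (2 * .X + 5) ?_).comp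
    ((PolyFun.const false).pair (((PolyFun.const (0, 1)).pair ((PolyFun.const 0).pair snd)).pair
      fst))))).of_eq fun x => rfl
  rintro x ⟨⟨u, v⟩, e, lab, out⟩ l l' hl'
  obtain ⟨h1, h2, h3, h4, h5, h6⟩ := kruskalStep_bounds l' ((u, v), (e, (lab, out)))
  change (enc (l'.foldl kruskalStep ((u, v), (e, (lab, out))))).height ≤ _
  generalize l'.foldl kruskalStep ((u, v), (e, (lab, out))) = s at *
  obtain ⟨⟨u', v'⟩, e', lab', out'⟩ := s
  have g1 := hl'.length_le
  have g2 := length_le_height l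
  have g3 := length_le_height lab
  have g4 := length_le_height out
  have g5 := height_listBool_le out'
  have g6 : (enc lab').height ≤ (enc lab).height + lab'.length := height_list_le fun c hc => by
    rw [height_nat]
    exact h6 (enc lab).height (fun c hc => (height_nat c).symm.trans_le (height_mem hc)) c hc
  obtain ⟨H, hH⟩ : ∃ H, H = (enc (x, ((u, v), (e, (lab, out))), l)).height := ⟨_, rfl⟩
  obtain ⟨-, hs⟩ := height_pair_le hH.ge
  obtain ⟨hs, hl⟩ := height_pair_le hs
  obtain ⟨huv, hs⟩ := height_pair_le hs
  obtain ⟨hu, hv⟩ := height_pair_le huv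
  obtain ⟨he, hs⟩ := height_pair_le hs
  obtain ⟨hlab, hout⟩ := height_pair_le hs
  rw [height_nat] at hu hv he
  simp only at h1 h2 h3 h4 h5
  rw [← hH, height_pair, height_pair, height_pair, height_pair, height_nat, height_nat, height_nat]
  simp only [Polynomial.eval_add, Polynomial.eval_mul, Polynomial.eval_X, Polynomial.eval_ofNat]
  refine Nat.succ_le_of_lt (Nat.lt_of_le_of_lt (m := 2 * H + 4) ?_ (by omega))
  refine max_le (Nat.succ_le_of_lt (max_lt (by omega) (by omega)))
    (Nat.succ_le_of_lt (max_lt (by omega) (Nat.lt_of_le_of_lt (m := 2 * H + 3)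
      (Nat.succ_le_of_lt (max_lt ?_ ?_)) (by omega))))
  · omega
  · omega

theorem polyFun_spanningForest :
    PolyFun fun x : ℕ × (List Bool × List Bool) => spanningForest x.1 x.2 :=
  polyFun_kruskal.comp₂ (snd.comp snd) (polyFun_kruskal.comp₂ (fst.comp snd)
    ((range.comp fst).pair (replicate_false.comp (choose_two.comp fst))))

theorem polyFun_forestCheck :
    PolyFun fun x : (ℕ × (List Bool × List Bool)) × (List ℕ × List Bool) =>
      forestCheck x.1.1 x.1.2 x.2 := by
  have h1 : PolyFun fun x : List ℕ × ℕ => decide (x.1.getD x.2 0 = x.1.getD 0 0) :=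
    decide_eq.comp₂ ((PolyFun.getD 0 rfl).comp₂ snd fst) ((PolyFun.getD 0 rfl).comp₂ (.const 0) fst)
  have h2 : PolyFun fun x : ((List Bool × List Bool) × List Bool) × ℕ =>
      (if bit x.1.1.1 x.2 then bit x.1.2 x.2 else true) &&
        if bit x.1.2 x.2 then bit x.1.1.2 x.2 else true := by
    have ha : PolyFun fun x : ((List Bool × List Bool) × List Bool) × ℕ => bit x.1.1.1 x.2 :=
      (fst.comp (fst.comp fst)).bit snd
    have hb : PolyFun fun x : ((List Bool × List Bool) × List Bool) × ℕ => bit x.1.1.2 x.2 :=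
      (snd.comp (fst.comp fst)).bit snd
    have hc : PolyFun fun x : ((List Bool × List Bool) × List Bool) × ℕ => bit x.1.2 x.2 :=
      (snd.comp fst).bit snd
    exact (ha.cond hc (.const true)).and (hc.cond hb (.const true))
  exact ((all h1).comp₂ (fst.comp snd) (range.comp (fst.comp fst))).and
    ((all h2).comp₂ ((snd.comp fst).pair (snd.comp snd))
      (range.comp (choose_two.comp (fst.comp fst))))

theorem polyFun_proposeTree : PolyFun proposeTree :=
  (polyFun_forestCheck.comp₂ PolyFun.id polyFun_spanningForest).cond
    (PolyFun.some.comp (PolyFun.id.pair (snd.comp polyFun_spanningForest))) (.const none)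

theorem polyFun_treeUpdate : PolyFun treeUpdate := by
  have he : PolyFun fun x : ((ℕ × (List Bool × List Bool)) × List Bool) × List ℕ => x.2.getD 0 0 :=
    (PolyFun.getD 0 rfl).comp₂ (.const 0) snd
  have hx : PolyFun fun x : ((ℕ × (List Bool × List Bool)) × List Bool) × List ℕ => x.1.1 :=
    fst.comp fst
  have hm := fst.comp (snd.comp hx)
  have ha := snd.comp (snd.comp hx)
  exact ((snd.comp fst).bit he).cond
    (polyFun_proposeTree.comp₂ (fst.comp hx) (hm.pair (set.comp₂ (he.pair (.const false)) ha)))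
    (polyFun_proposeTree.comp₂ (fst.comp hx) ((set.comp₂ (he.pair (.const true)) hm).pair ha))

end

/-! #### Correctness -/

theorem choose_two_succ (v : ℕ) : (v + 1).choose 2 = v.choose 2 + v := by
  rw [Nat.choose_succ_succ' v 1, Nat.choose_one_right, add_comm]

/-- The pairs with larger element `v` occupy the numbers from `v choose 2` up to, but excluding, `(v
+ 1) choose 2`. -/
theorem pairIndex_lt {u v n : ℕ} (huv : u < v) (hv : v < n) : v.choose 2 + u < n.choose 2 := by
  have h1 := Nat.choose_le_choose 2 (Nat.succ_le_of_lt hv)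
  have h2 := choose_two_succ v
  simp only [Nat.succ_eq_add_one] at h1
  omega

theorem pairIndex_injective {u v u' v' : ℕ} (huv : u < v) (huv' : u' < v')
    (h : v.choose 2 + u = v'.choose 2 + u') : u = u' ∧ v = v' := by
  rcases lt_trichotomy v v' with hv | rfl | hv
  · have := pairIndex_lt huv hv
    omega
  · exact ⟨by omega, rfl⟩
  · have := pairIndex_lt huv' hv
    omega

/-- The graph given by a list of bits. -/
abbrev listGraph (n : ℕ) (l : List Bool) : SimpleGraph (Fin n) := graphOf (assignOf (n.choose 2) l)

theorem listGraph_adj {n : ℕ} {l : List Bool} {u v : Fin n} (huv : u < v) :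
    (listGraph n l).Adj u v ↔ bit l ((v : ℕ).choose 2 + u) = true := by
  have h : max (u : ℕ) v = v := max_eq_right (le_of_lt huv)
  have h' : min (u : ℕ) v = u := min_eq_left (le_of_lt huv)
  simp only [listGraph, graphOf, h, h']
  constructor
  · rintro ⟨-, e, he, hl⟩
    rw [assignOf_eq_one, he] at hl
    exact hl
  · intro hl
    exact ⟨huv.ne, ⟨_, pairIndex_lt huv v.2⟩, rfl, assignOf_eq_one.2 hl⟩

theorem listGraph_mono {n : ℕ} {l l' : List Bool} (h : ∀ k, bit l k = true → bit l' k = true) :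
    listGraph n l ≤ listGraph n l' :=
  graphOf_mono (bitFun_le_iff_one.2 fun i hi => assignOf_eq_one.2 (h i (assignOf_eq_one.1 hi)))

theorem listGraph_set {n : ℕ} {l : List Bool} (hl : l.length = n.choose 2) {u v : Fin n}
    (huv : u < v) : listGraph n (l.set ((v : ℕ).choose 2 + u) true) =
      listGraph n l ⊔ SimpleGraph.edge u v := by
  have key : ∀ a b : Fin n, a < b → ((listGraph n (l.set ((v : ℕ).choose 2 + u) true)).Adj a b ↔
      (listGraph n l ⊔ SimpleGraph.edge u v).Adj a b) := by
    intro a b hab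
    rw [listGraph_adj hab, SimpleGraph.sup_adj, listGraph_adj hab, SimpleGraph.edge_adj,
      bit_set (by rw [hl]; exact pairIndex_lt huv v.2)]
    split_ifs with h
    · obtain ⟨h1, h2⟩ := pairIndex_injective hab huv h
      simp only [true_iff]
      exact .inr ⟨.inl ⟨Fin.ext h1, Fin.ext h2⟩, hab.ne⟩
    · refine ⟨.inl, fun h' => h'.resolve_right ?_⟩
      rintro ⟨⟨rfl, rfl⟩ | ⟨rfl, rfl⟩, -⟩
      · exact h rfl
      · exact absurd hab (not_lt_of_gt huv)
  ext a b
  rcases lt_trichotomy a b with h | rfl | h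
  · exact key a b h
  · simp
  · rw [SimpleGraph.adj_comm, key b a h, SimpleGraph.adj_comm]

/-- A forest together with the labels of its components. -/
structure IsForest (n : ℕ) (x : List ℕ × List Bool) : Prop where
  length_fst : x.1.length = n
  length_snd : x.2.length = n.choose 2
  acyclic : (listGraph n x.2).IsAcyclic
  label_eq_iff : ∀ u v : Fin n, x.1.getD u 0 = x.1.getD v 0 ↔ (listGraph n x.2).Reachable u v

theorem eq_of_reachable {V α : Type} {G : SimpleGraph V} {f : V → α}
    (h : ∀ u v, G.Adj u v → f u = f v) {u v : V} (huv : G.Reachable u v) : f u = f v := by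
  obtain ⟨p⟩ := huv
  induction p with
  | nil => rfl
  | cons hadj _ ih => rw [h _ _ hadj, ih]

/-- An edge is added only between different components, so no cycle arises. The new labels are
constant along the old edges and the new one; conversely, equal new labels come from equal old ones
or from a connection through the new edge. -/
theorem IsForest.addEdge {n : ℕ} {x : List ℕ × List Bool} (h : IsForest n x) (b : Bool) {u v : Fin n}
    (huv : u < v) {e : ℕ} (he : e = (v : ℕ).choose 2 + u) :
    IsForest n (addEdge b u v e x) ∧
      (b = true → (listGraph n (HiddenCSP.addEdge b u v e x).2).Reachable u v) ∧
      (∀ k, bit x.2 k = true → bit (HiddenCSP.addEdge b u v e x).2 k = true) ∧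
      ∀ k, bit (HiddenCSP.addEdge b u v e x).2 k = true → bit x.2 k = true ∨ k = e ∧ b = true := by
  obtain ⟨lab, out⟩ := x
  have hlab : lab.length = n := h.length_fst
  have hout : out.length = n.choose 2 := h.length_snd
  have hlt : e < out.length := by rw [hout, he]; exact pairIndex_lt huv v.2
  unfold HiddenCSP.addEdge
  simp only [Bool.and_eq_true, Bool.not_eq_true', decide_eq_false_iff_not]
  split_ifs with hb
  · obtain ⟨hb, hne⟩ := hb
    have hnr : ¬ (listGraph n out).Reachable u v := fun hr => hne ((h.label_eq_iff u v).2 hr)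
    have hG : listGraph n (out.set e true) = listGraph n out ⊔ SimpleGraph.edge u v := by
      rw [he]; exact listGraph_set hout huv
    have hadj : (listGraph n (out.set e true)).Adj u v := by
      rw [hG, SimpleGraph.sup_adj, SimpleGraph.edge_adj]
      exact .inr ⟨.inl ⟨rfl, rfl⟩, huv.ne⟩
    have hle : listGraph n out ≤ listGraph n (out.set e true) := hG ▸ le_sup_left
    have hget : ∀ w : Fin n, (lab.map fun c => if c = lab.getD v 0 then lab.getD u 0 else c).getD w 0 =
        if lab.getD w 0 = lab.getD v 0 then lab.getD u 0 else lab.getD w 0 := by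
      intro w
      have hw : (w : ℕ) < lab.length := hlab ▸ w.2
      simp [List.getD_eq_getElem?_getD, hw]
    refine ⟨⟨by simpa using hlab, by simpa using hout, ?_, fun a c => ?_⟩, fun _ => hadj.reachable,
      fun k hk => ?_, fun k hk => ?_⟩
    · simp only [hG]
      exact (SimpleGraph.isAcyclic_add_edge_iff_of_not_reachable u v hnr).2 h.acyclic
    · have hR : ∀ a c : Fin n, lab.getD a 0 = lab.getD c 0 →
          (listGraph n (out.set e true)).Reachable a c := fun a c hac =>
        ((h.label_eq_iff a c).1 hac).mono hle
      rw [hget, hget]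
      constructor
      · intro hac
        split_ifs at hac with h1 h2 h2
        · exact hR a c (h1.trans h2.symm)
        · exact ((hR a v h1).trans hadj.symm.reachable).trans (hR u c hac)
        · exact ((hR a u hac).trans hadj.reachable).trans (hR v c h2.symm)
        · exact hR a c hac
      · intro hac
        refine eq_of_reachable (f := fun w : Fin n =>
          if lab.getD w 0 = lab.getD v 0 then lab.getD u 0 else lab.getD w 0) (fun p q hpq => ?_) hac
        simp only at hpq ⊢
        rw [hG, SimpleGraph.sup_adj, SimpleGraph.edge_adj] at hpq
        rcases hpq with hpq | ⟨⟨rfl, rfl⟩ | ⟨rfl, rfl⟩, -⟩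
        · have := (h.label_eq_iff p q).2 hpq.reachable
          simp only at this
          rw [this]
        · simp
        · simp
    · rw [bit_set hlt]
      split_ifs
      · rfl
      · exact hk
    · rw [bit_set hlt] at hk
      split_ifs at hk with hke
      · exact .inr ⟨hke, hb⟩
      · exact .inl hk
  · refine ⟨h, fun hb' => ?_, fun _ hk => hk, fun _ hk => .inl hk⟩
    exact (h.label_eq_iff u v).1 (by_contra fun hne => hb ⟨hb', hne⟩)

/-- Here `l` is the unread part of the bit list and `e` is the number of the current pair, so the
pair with number `k` belongs to the entry `k - e` of `l`. -/
theorem foldl_kruskalStep_spec {n : ℕ} (l : List Bool) : ∀ (u v e : ℕ) (x : List ℕ × List Bool),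
    u < v → e = v.choose 2 + u → e + l.length = n.choose 2 → IsForest n x →
    IsForest n (l.foldl kruskalStep ((u, v), (e, x))).2.2 ∧
      (∀ k, bit x.2 k = true → bit (l.foldl kruskalStep ((u, v), (e, x))).2.2.2 k = true) ∧
      (∀ k, bit (l.foldl kruskalStep ((u, v), (e, x))).2.2.2 k = true →
        bit x.2 k = true ∨ e ≤ k ∧ bit l (k - e) = true) ∧
      ∀ a c : Fin n, a < c → e ≤ (c : ℕ).choose 2 + a →
        bit l ((c : ℕ).choose 2 + a - e) = true →
        (listGraph n (l.foldl kruskalStep ((u, v), (e, x))).2.2.2).Reachable a c := by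
  induction l with
  | nil => exact fun u v e x _ _ _ hx => ⟨hx, fun _ h => h, fun _ h => .inl h, by simp⟩
  | cons b l ih =>
    intro u v e x huv he hel hx
    rw [List.length_cons] at hel
    -- While entries remain, `e` is below `n choose 2`, which would fail for `v ≥ n`.
    have hv : v < n := by
      by_contra hv
      have := Nat.choose_le_choose 2 (not_lt.1 hv)
      omega
    obtain ⟨g1, g2, g3, g4⟩ := hx.addEdge b (u := ⟨u, by omega⟩) (v := ⟨v, hv⟩) huv he
    simp only at g1 g2 g3 g4
    obtain ⟨u', v', hs, huv', he'⟩ : ∃ u' v', kruskalStep ((u, v), (e, x)) b =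
        ((u', v'), (e + 1, addEdge b u v e x)) ∧ u' < v' ∧ e + 1 = v'.choose 2 + u' := by
      by_cases huv1 : u + 1 = v
      · exact ⟨0, v + 1, by simp [kruskalStep, huv1], by omega, by rw [choose_two_succ]; omega⟩
      · exact ⟨u + 1, v, by simp [kruskalStep, huv1], by omega, by omega⟩
    rw [List.foldl_cons, hs]
    obtain ⟨k1, k2, k3, k4⟩ := ih u' v' (e + 1) _ huv' he' (by omega) g1
    refine ⟨k1, fun k hk => k2 k (g3 k hk), fun k hk => ?_, fun a c hac hle hbit => ?_⟩
    · rcases k3 k hk with h | ⟨h, h'⟩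
      · rcases g4 k h with h | ⟨rfl, rfl⟩
        · exact .inl h
        · exact .inr ⟨le_rfl, by simp⟩
      · refine .inr ⟨by omega, ?_⟩
        rw [show k - e = k - (e + 1) + 1 by omega]
        simpa using h'
    · rcases Nat.eq_or_lt_of_le hle with heq | hlt
      · obtain ⟨rfl, rfl⟩ := pairIndex_injective huv hac (he ▸ heq)
        rw [← heq] at hbit
        exact (g2 (by simpa using hbit)).mono (listGraph_mono k2)
      · refine k4 a c hac hlt ?_
        rw [show (c : ℕ).choose 2 + a - e = (c : ℕ).choose 2 + a - (e + 1) + 1 by omega] at hbit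
        simpa using hbit

theorem kruskal_spec {n : ℕ} {l : List Bool} (hl : l.length = n.choose 2) {x : List ℕ × List Bool}
    (hx : IsForest n x) : IsForest n (kruskal l x) ∧
      (∀ k, bit x.2 k = true → bit (kruskal l x).2 k = true) ∧
      (∀ k, bit (kruskal l x).2 k = true → bit x.2 k = true ∨ bit l k = true) ∧
      ∀ u v : Fin n, (listGraph n l).Adj u v → (listGraph n (kruskal l x).2).Reachable u v := by
  obtain ⟨h1, h2, h3, h4⟩ := foldl_kruskalStep_spec (n := n) l 0 1 0 x (by omega) (by simp)
    (by omega) hx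
  refine ⟨h1, h2, fun k hk => (h3 k hk).imp_right fun h => h.2, fun u v huv => ?_⟩
  have key : ∀ u v : Fin n, u < v → (listGraph n l).Adj u v →
      (listGraph n (kruskal l x).2).Reachable u v := fun u v h huv =>
    h4 u v h (Nat.zero_le _) ((listGraph_adj h).1 huv)
  rcases lt_trichotomy u v with h | rfl | h
  · exact key u v h huv
  · exact .refl _
  · exact (key v u h huv.symm).symm

theorem bit_replicate_false (n k : ℕ) : bit (List.replicate n false) k = false := by
  rcases lt_or_ge k n with h | h
  · exact bit_replicate h false
  · exact bit_of_length_le (by simpa using h)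

theorem isForest_empty (n : ℕ) : IsForest n (List.range n, List.replicate (n.choose 2) false) := by
  have hbot : listGraph n (List.replicate (n.choose 2) false) = ⊥ := by
    refine eq_bot_iff.2 fun u v ⟨_, e, _, he⟩ => ?_
    rw [assignOf_eq_one, bit_replicate_false] at he
    cases he
  refine ⟨by simp, by simp, ?_, fun u v => ?_⟩
  · simp only [hbot]
    exact SimpleGraph.isAcyclic_bot
  · simp only [hbot, SimpleGraph.reachable_bot]
    simp [List.getD_eq_getElem?_getD, Fin.ext_iff]

theorem spanningForest_isForest {n : ℕ} {y : List Bool × List Bool} (h1 : y.1.length = n.choose 2)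
    (h2 : y.2.length = n.choose 2) : IsForest n (spanningForest n y) :=
  (kruskal_spec h2 (kruskal_spec h1 (isForest_empty n)).1).1

theorem forestCheck_iff {n : ℕ} {y : List Bool × List Bool} {x : List ℕ × List Bool} :
    forestCheck n y x = true ↔ (∀ i < n, x.1.getD i 0 = x.1.getD 0 0) ∧
      ∀ e < n.choose 2, (bit y.1 e = true → bit x.2 e = true) ∧
        (bit x.2 e = true → bit y.2 e = true) := by
  rw [forestCheck, Bool.and_eq_true, List.all_eq_true, List.all_eq_true]
  refine and_congr (by simp only [List.mem_range, decide_eq_true_eq]) (forall_congr' fun e => ?_)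
  rw [List.mem_range]
  refine imp_congr_right fun _ => ?_
  cases bit y.1 e <;> cases bit x.2 e <;> cases bit y.2 e <;> simp

theorem IsForest.isTree {n : ℕ} (hn : 0 < n) {x : List ℕ × List Bool} (h : IsForest n x)
    (hx : ∀ i < n, x.1.getD i 0 = x.1.getD 0 0) : (listGraph n x.2).IsTree := by
  have : Nonempty (Fin n) := ⟨⟨0, hn⟩⟩
  refine ⟨⟨fun u v => (h.label_eq_iff u v).1 ?_⟩, h.acyclic⟩
  rw [hx u u.2, hx v v.2]

/-- Let `T` be the tree given by `l`. The first run keeps every required pair, because edges of `T`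
are bridges of `T`. The second run connects the ends of every allowed pair, in particular of every
edge of `T`, so the result spans. It uses allowed pairs only, since required pairs lie in `T` and
are therefore allowed. -/
theorem forestCheck_of_isTree {n : ℕ} {y : List Bool × List Bool} (h1 : y.1.length = n.choose 2)
    (h2 : y.2.length = n.choose 2) {l : List Bool} (hl : (listGraph n l).IsTree)
    (hl1 : ∀ k, bit y.1 k = true → bit l k = true) (hl2 : ∀ k, bit l k = true → bit y.2 k = true) :
    forestCheck n y (spanningForest n y) = true := by
  obtain ⟨f1, -, f3, f4⟩ := kruskal_spec h1 (isForest_empty n)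
  obtain ⟨g1, g2, g3, g4⟩ := kruskal_spec h2 f1
  have f3' : ∀ k, bit (kruskal y.1 (List.range n, List.replicate (n.choose 2) false)).2 k = true →
      bit y.1 k = true := fun k hk => (f3 k hk).resolve_left (by
    simp only [bit_replicate_false]; simp)
  refine forestCheck_iff.2 ⟨fun i hi => ?_, fun e he => ⟨fun hy => g2 e ?_, fun hx => ?_⟩⟩
  · have hreach := hl.1.preconnected ⟨i, hi⟩ ⟨0, by omega⟩
    refine (g1.label_eq_iff ⟨i, hi⟩ ⟨0, by omega⟩).2 ?_
    have hstep : ∀ u v, (listGraph n l).Adj u v →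
        (listGraph n (spanningForest n y).2).connectedComponentMk u =
          (listGraph n (spanningForest n y).2).connectedComponentMk v := fun u v huv =>
      SimpleGraph.ConnectedComponent.sound (g4 u v (listGraph_mono hl2 huv))
    exact SimpleGraph.ConnectedComponent.exact (eq_of_reachable hstep hreach)
  · by_contra hne
    -- Every number below `n choose 2` belongs to a pair; this inverts the numbering.
    obtain ⟨u, v, huv, hv, rfl⟩ : ∃ u v, u < v ∧ v < n ∧ e = v.choose 2 + u := by
      clear * - he
      induction n with
      | zero => simp at he
      | succ n ih =>
        rcases lt_or_ge e (n.choose 2) with h | h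
        · obtain ⟨u, v, h1, h2, h3⟩ := ih h
          exact ⟨u, v, h1, by omega, h3⟩
        · rw [choose_two_succ] at he
          exact ⟨e - n.choose 2, n, by omega, by omega, by omega⟩
    obtain ⟨u, rfl⟩ : ∃ u' : Fin n, u = u' := ⟨⟨u, by omega⟩, rfl⟩
    obtain ⟨v, rfl⟩ : ∃ v' : Fin n, v = v' := ⟨⟨v, hv⟩, rfl⟩
    have huv : u < v := huv
    -- If the required pair were omitted, the first forest would still connect its ends, through
    -- required pairs different from it. These are edges of the tree, contradicting that the pair is
    -- a bridge.
    have hbr := SimpleGraph.isAcyclic_iff_forall_adj_isBridge.1 hl.2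
      ((listGraph_adj huv).2 (hl1 _ hy))
    refine hbr ((f4 u v ((listGraph_adj huv).2 hy)).mono fun a c hac => ?_)
    rw [SimpleGraph.deleteEdges_adj]
    refine ⟨listGraph_mono (fun k hk => hl1 k (f3' k hk)) hac, fun hmem => hne ?_⟩
    rw [← listGraph_adj huv]
    rcases Sym2.eq_iff.1 (Set.mem_singleton_iff.1 hmem) with ⟨rfl, rfl⟩ | ⟨rfl, rfl⟩
    · exact hac
    · exact hac.symm
  · rcases g3 e hx with h | h
    · exact hl2 e (hl1 e (f3' e h))
    · exact h

/-- The state `x` of the algorithm is consistent with the instance, and the proposal is a tree that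
is consistent with the state. -/
structure TreeInv {n m : ℕ} (C : equalitySpanningTree.Instance n m) (r : ℕ)
    (x : (ℕ × (List Bool × List Bool)) × List Bool) : Prop where
  fst_eq : x.1.1 = n
  length_must : x.1.2.1.length = n.choose 2
  length_allowed : x.1.2.2.length = n.choose 2
  length_tree : x.2.length = n.choose 2
  isTree : (listGraph n x.2).IsTree
  must_le : ∀ e < n.choose 2, bit x.1.2.1 e = true → bit x.2 e = true
  le_allowed : ∀ e < n.choose 2, bit x.2 e = true → bit x.1.2.2 e = true
  sound : ∀ z : Fin (n.choose 2) → Fin 2, CSP.Satisfies (S := equalitySpanningTree) z C →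
    ∀ e : Fin (n.choose 2), (bit x.1.2.1 e = true → z e = 1) ∧ (z e = 1 → bit x.1.2.2 e = true)
  rank : r = ((Finset.range (n.choose 2)).filter fun e => bit x.1.2.1 e = false).card +
    ((Finset.range (n.choose 2)).filter fun e => bit x.1.2.2 e = true).card

/-- The check decides whether any tree fits the recorded facts: if it succeeds, the forest is such a
tree, and if it fails, `forestCheck_of_isTree` excludes every solution. -/
theorem proposeTree_spec {n m : ℕ} (hn : 0 < n) (C : equalitySpanningTree.Instance n m)
    {must allowed : List Bool} (h1 : must.length = n.choose 2) (h2 : allowed.length = n.choose 2)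
    (hs : ∀ z : Fin (n.choose 2) → Fin 2, CSP.Satisfies (S := equalitySpanningTree) z C →
      ∀ e : Fin (n.choose 2), (bit must e = true → z e = 1) ∧ (z e = 1 → bit allowed e = true)) :
    (proposeTree (n, (must, allowed)) = none →
      ∀ a ∈ equalitySpanningTree.W n, ¬ CSP.Satisfies a C) ∧
    ∀ x, proposeTree (n, (must, allowed)) = some x →
      TreeInv C (((Finset.range (n.choose 2)).filter fun e => bit must e = false).card +
        ((Finset.range (n.choose 2)).filter fun e => bit allowed e = true).card) x := by
  have hF := spanningForest_isForest (n := n) (y := (must, allowed)) h1 h2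
  unfold proposeTree
  split_ifs with hc
  · refine ⟨fun h => by simp at h, fun x hx => ?_⟩
    obtain rfl := Option.some.inj hx
    obtain ⟨c1, c2⟩ := forestCheck_iff.1 hc
    exact ⟨rfl, h1, h2, hF.length_snd, hF.isTree hn c1, fun e he => (c2 e he).1,
      fun e he => (c2 e he).2, hs, rfl⟩
  · suffices key : ∀ z : Fin (n.choose 2) → Fin 2, (graphOf z).IsTree →
        ¬ CSP.Satisfies (S := equalitySpanningTree) z C from
      ⟨fun _ z hz => key z hz, fun x hx => by simp at hx⟩
    refine fun z hz hzC => hc ?_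
    have hbit : ∀ e : Fin (n.choose 2), bit (bitsOf z) e = true ↔ z e = 1 := fun e => by
      rw [bit_bitsOf, decide_eq_true_eq]
    refine forestCheck_of_isTree h1 h2 (l := bitsOf z) ?_ (fun k hk => ?_) fun k hk => ?_
    · rw [listGraph, assignOf_bitsOf]
      exact hz
    · have hlt : k < n.choose 2 := by
        by_contra h
        rw [bit_of_length_le (by simp only; omega)] at hk
        cases hk
      exact (hbit ⟨k, hlt⟩).2 ((hs z hzC ⟨k, hlt⟩).1 hk)
    · have hlt : k < n.choose 2 := by
        by_contra h
        rw [bit_of_length_le (by rw [length_bitsOf]; omega)] at hk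
        cases hk
      exact (hs z hzC ⟨k, hlt⟩).2 ((hbit ⟨k, hlt⟩).1 hk)

theorem card_filter_bit_set {l : List Bool} {N e : ℕ} (hl : l.length = N) (he : e < N) {b : Bool}
    (hb : bit l e = b) : ((Finset.range N).filter fun k => bit (l.set e !b) k = b).card <
      ((Finset.range N).filter fun k => bit l k = b).card := by
  refine Finset.card_lt_card (Finset.ssubset_iff_of_subset (fun k hk => ?_) |>.2 ⟨e, ?_, ?_⟩)
  · rw [Finset.mem_filter, bit_set (by omega)] at hk
    rw [Finset.mem_filter]
    refine ⟨hk.1, ?_⟩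
    have := hk.2
    split_ifs at this with hke
    · cases b <;> simp at this
    · exact this
  · rw [Finset.mem_filter]
    exact ⟨by simpa using he, hb⟩
  · rw [Finset.mem_filter, bit_set (by omega), if_pos rfl]
    cases b <;> simp

theorem choose_two_le (n : ℕ) : n.choose 2 ≤ n * n :=
  (Nat.choose_le_pow n 2).trans_eq (sq n)

theorem hiddenPolyTime_equalitySpanningTree : equalitySpanningTree.HiddenPolyTime := by
  refine hiddenPolyTime_of_learner (τ := ℕ × (List Bool × List Bool)) (π := List Bool)
    (fun n => proposeTree (n.1, (List.replicate (n.1.choose 2) false,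
      List.replicate (n.1.choose 2) true))) ?_ treeUpdate polyFun_treeUpdate
    (fun C r x => TreeInv C r x) (2 * (.X * .X)) (.X * .X + .X + 4) ?_ ?_ ?_ ?_
  · have h : PolyFun fun n : {n : ℕ // 0 < n} => n.1 :=
      (PolyFun.id (α := ℕ)).congr_enc (fun n => n.1) (fun _ => rfl) (fun _ => rfl)
    have hc := PolyFun.choose_two.comp h
    exact polyFun_proposeTree.comp₂ h
      (((PolyFun.replicate false).comp hc).pair ((PolyFun.replicate true).comp hc))
  · intro n m C hn
    obtain ⟨h1, h2⟩ := proposeTree_spec hn C (must := List.replicate (n.choose 2) false)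
      (allowed := List.replicate (n.choose 2) true) (by simp) (by simp) fun z _ e =>
        ⟨fun h => absurd h (by rw [bit_replicate e.2]; decide), fun _ => bit_replicate e.2 true⟩
    refine ⟨h1, fun x hx => ⟨_, ?_, h2 x hx⟩⟩
    have h3 := choose_two_le n
    have h4 := Finset.card_filter_le (Finset.range (n.choose 2))
      fun e => bit (List.replicate (n.choose 2) false) e = false
    have h5 := Finset.card_filter_le (Finset.range (n.choose 2))
      fun e => bit (List.replicate (n.choose 2) true) e = true
    rw [Finset.card_range] at h4 h5
    simp only [Polynomial.eval_mul, Polynomial.eval_X, Polynomial.eval_ofNat]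
    omega
  · rintro n m C r ⟨⟨n', must, allowed⟩, l⟩ h
    have h1 := h.fst_eq
    have h2 := h.length_must
    have h3 := h.length_allowed
    have h4 := h.length_tree
    have h5 := choose_two_le n
    have h6 := height_listBool_le must
    have h7 := height_listBool_le allowed
    have h8 := height_listBool_le l
    simp only [height_pair, height_nat, Polynomial.eval_add, Polynomial.eval_mul, Polynomial.eval_X,
      Polynomial.eval_ofNat] at *
    omega
  · intro n v
    refine (height_ofTuple_le v).trans ?_
    have h5 := choose_two_le n
    change n.choose 2 + 1 ≤ _
    simp only [Polynomial.eval_add, Polynomial.eval_mul, Polynomial.eval_X, Polynomial.eval_ofNat]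
    omega
  · rintro n m C r ⟨⟨n', must, allowed⟩, l⟩ h
    obtain rfl : n' = n := h.fst_eq
    have hlen : l.length = n'.choose 2 := h.length_tree
    have hm : must.length = n'.choose 2 := h.length_must
    have ha : allowed.length = n'.choose 2 := h.length_allowed
    have hsound := h.sound
    have hrank := h.rank
    have hmust := h.must_le
    have hallowed := h.le_allowed
    simp only at hsound hrank hmust hallowed
    -- Positivity is not part of the invariant; it holds because a tree has a vertex.
    have hn : 0 < n' := by
      obtain ⟨v⟩ := h.isTree.1.nonempty
      exact v.pos
    refine ⟨assignOf (n'.choose 2) l, h.isTree, enc_eq_ofTuple hlen, fun j hj => ?_⟩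
    obtain ⟨e, he⟩ : ∃ e : Fin (n'.choose 2), e = (C j).vars (0 : Fin 1) := ⟨_, rfl⟩
    have hl : (List.ofFn fun i => ((C j).vars i : ℕ)).getD 0 0 = e := by rw [he]; rfl
    have hrel : (C j).rel = idRel ∨ (C j).rel = negRel := (C j).rel_mem
    have hid : (C j).rel = idRel → ∀ z : Fin (n'.choose 2) → Fin 2,
        (C j).Sat (S := equalitySpanningTree) z ↔ z e = 1 := by
      intro h z
      unfold CSP.Constraint.Sat
      rw [h, he]
      rfl
    have hneg : (C j).rel = negRel → ∀ z : Fin (n'.choose 2) → Fin 2,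
        (C j).Sat (S := equalitySpanningTree) z ↔ z e = 0 := by
      intro h z
      unfold CSP.Constraint.Sat
      rw [h, he]
      rfl
    unfold treeUpdate
    simp only [hl]
    split_ifs with hle
    -- The value proposed at `e` reveals the relation: a violated constraint on a chosen pair cannot
    -- be `idRel`, and one on an omitted pair cannot be `negRel`.
    · have hsat : ∀ z : Fin (n'.choose 2) → Fin 2,
          CSP.Satisfies (S := equalitySpanningTree) z C → z e = 0 := fun z hz => by
        rcases hrel with h | h
        · exact (hj ((hid h _).2 (assignOf_eq_one.2 hle))).elim
        · exact (hneg h z).1 (hz j)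
      obtain ⟨p1, p2⟩ := proposeTree_spec hn C (must := must) (allowed := allowed.set e false) hm
        (by simpa using ha) fun z hz k => ⟨(hsound z hz k).1, fun hk => by
          rw [bit_set (by rw [ha]; exact e.2), if_neg]
          · exact (hsound z hz k).2 hk
          · intro hke
            rw [Fin.ext hke, hsat z hz] at hk
            exact absurd hk (by decide)⟩
      refine ⟨p1, fun x' hx' => ⟨_, ?_, p2 x' hx'⟩⟩
      have := card_filter_bit_set ha e.2 (hallowed e e.2 hle)
      simp only [Bool.not_true] at this
      omega
    · have hle' : bit l e = false := by simpa using hle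
      have hsat : ∀ z : Fin (n'.choose 2) → Fin 2,
          CSP.Satisfies (S := equalitySpanningTree) z C → z e = 1 := fun z hz => by
        rcases hrel with h | h
        · exact (hid h z).1 (hz j)
        · refine (hj ((hneg h _).2 ?_)).elim
          rw [assignOf, hle']
          rfl
      obtain ⟨p1, p2⟩ := proposeTree_spec hn C (must := must.set e true) (allowed := allowed)
        (by simpa using hm) ha fun z hz k => ⟨fun hk => by
          rw [bit_set (by rw [hm]; exact e.2)] at hk
          split_ifs at hk with hke
          · rw [Fin.ext hke]; exact hsat z hz
          · exact (hsound z hz k).1 hk, (hsound z hz k).2⟩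
      refine ⟨p1, fun x' hx' => ⟨_, ?_, p2 x' hx'⟩⟩
      -- The proposal contains all required pairs, so an omitted pair was not required before and
      -- the rank drops.
      have hme : bit must e = false := by
        rw [← Bool.not_eq_true]
        exact fun h => hle (hmust e e.2 h)
      have := card_filter_bit_set hm e.2 hme
      simp only [Bool.not_false] at this
      omega

end HiddenCSP

theorem mainTheorem8 :
    -- (a) 2-SAT, and arbitrary sets of binary Boolean relations
    (twoSAT.HiddenPolyTime ∧
      ∀ R : ℕ → Set (Set (Fin 2 → Fin 2)), (binaryBoolean R).HiddenPolyTime) ∧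
    -- (b) exact unique games over an alphabet with two letters
    (uniqueGames 2).HiddenPolyTime ∧
    -- (c) polynomial-time monotone properties of graphs and of directed graphs
    ((∀ P : ∀ n, SimpleGraph (Fin n) → Prop,
        DecidablePolyTime (fun n => n.choose 2) (fun n a => P n (graphOf a)) →
          ((∀ n, Monotone (P n)) →
            (increasingCSP (fun n => n.choose 2) fun n a => P n (graphOf a)).HiddenPolyTime) ∧
          ((∀ n, Antitone (P n)) →
            (decreasingCSP (fun n => n.choose 2) fun n a => P n (graphOf a)).HiddenPolyTime)) ∧
      (∀ P : ∀ n, Digraph (Fin n) → Prop,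
        DecidablePolyTime (fun n => n * n) (fun n a => P n (digraphOf a)) →
          ((∀ n, Monotone (P n)) →
            (increasingCSP (fun n => n * n) fun n a => P n (digraphOf a)).HiddenPolyTime) ∧
          ((∀ n, Antitone (P n)) →
            (decreasingCSP (fun n => n * n) fun n a => P n (digraphOf a)).HiddenPolyTime))) ∧
    -- (d) equality to a spanning tree
    equalitySpanningTree.HiddenPolyTime := by
  refine ⟨⟨hiddenPolyTime_twoSAT, hiddenPolyTime_binaryBoolean⟩, hiddenPolyTime_uniqueGames,
    ⟨fun P hP => ⟨fun h => ?_, fun h => ?_⟩, fun P hP => ⟨fun h => ?_, fun h => ?_⟩⟩,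
    hiddenPolyTime_equalitySpanningTree⟩
  · exact hiddenPolyTime_increasingCSP PolyFun.choose_two hP fun n => (h n).comp graphOf_mono
  · exact hiddenPolyTime_decreasingCSP PolyFun.choose_two hP fun n =>
      (h n).comp_monotone graphOf_mono
  · exact hiddenPolyTime_increasingCSP PolyFun.mul_self hP fun n => (h n).comp digraphOf_mono
  · exact hiddenPolyTime_decreasingCSP PolyFun.mul_self hP fun n =>
      (h n).comp_monotone digraphOf_mono
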